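/- A mixed graph is identified with the digraph obtained by replacing each undirected edge by a digon (two opposite arcs). It is totally regular of degree $(r,z)$ if every vertex is incident with exactly $r$ edges and has exactly $z$ out-going and $z$ in-coming arcs not belonging to digons; its diameter is the maximum directed distance. For $r\ge 1$ and $d=r+z$, the Moore bound for bipartite mixed graphs with undirected degree $r$, directed out-degree $z$ and diameter $k$ is $$M_B(r,z,k)=2\left(A\,\frac{u_1^{k+1}-u_1}{u_1^2-1}+B\,\frac{u_2^{k+1}-u_2}{u_2^2-1}\right),\qquad u_{1,2}=\frac{d-1\mp\sqrt v}{2},\quad A=\frac{\sqrt v-(d+1)}{2\sqrt v},\quad B=\frac{\sqrt v+(d+1)}{2\sqrt v},\quad v=(d-1)^2+4z.$$ A Moore bipartite graph of degree $\Delta$ and diameter $D$ is a finite bipartite $\Delta$-regular graph with diameter $D$ and order $2\sum_{i=0}^{D-1}(\Delta-1)^i$. The line digraph $L(G)$ of a digraph $G$ has the arcs of $G$ as vertices, with $(u,v)$ adjacent to $(u',v')$ if and only if $v=u'$; a graph is regarded as a symmetric digraph. Let $D\in\{3,4,6\}$ and $k=D+1\in\{4,5,7\}$. Then: (i) for every prime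 power $q$ there exists a Moore bipartite graph of degree $q+1$ and diameter $D$; (ii) for every Moore bipartite graph $G$ of degree $z+1$ and diameter $D$, the line digraph $L(G)$ is a bipartite mixed graph, totally regular of degree $(1,z)$, with diameter $k$ and order $2(z+1)\sum_{i=0}^{D-1}z^i$; (iii) the orders of these mixed graphs asymptotically attain the Moore bound: for every $\varepsilon>0$ there is $z_0$ such that, for all $z\ge z_0$ and every Moore bipartite graph $G$ of degree $z+1$ and diameter $D$, the order $N$ of $L(G)$ satisfies $|N/M_B(1,z,k)-1|<\varepsilon$. In particular, there exist families of bipartite mixed graphs with $r=1$ and diameter $k=4,5,7$, one for each prime power $z$, whose orders are asymptotically equal to $M_B(1,z,k)$ as $z\to\infty$. -/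

import Mathlib

/-! A (finite) mixed graph is identified with its associated digraph, in which every edge is
replaced by a digon, that is, by two opposite arcs.  Hence in a `Digraph` standing for a mixed
graph, the pairs `{u, v}` with `Adj u v` and `Adj v u` are the (undirected) edges, and the pairs
`(u, v)` with `Adj u v` but not `Adj v u` are the (directed) arcs. -/

namespace BipMixed

/-- The number of edges (digons) incident to `v`. -/
noncomputable def undirDegree {V : Type*} (G : Digraph V) (v : V) : ℕ :=
  Set.ncard {w : V | G.Adj v w ∧ G.Adj w v}

/-- The number of directed arcs (not belonging to a digon) emanating from `v`. -/
noncomputable def outDegree {V : Type*} (G : Digraph V) (v : V) : ℕ :=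
  Set.ncard {w : V | G.Adj v w ∧ ¬ G.Adj w v}

/-- The number of directed arcs (not belonging to a digon) going to `v`. -/
noncomputable def inDegree {V : Type*} (G : Digraph V) (v : V) : ℕ :=
  Set.ncard {w : V | G.Adj w v ∧ ¬ G.Adj v w}

/-- The mixed graph `G` is totally regular of degree `(r, z)`. -/
def IsTotallyRegular {V : Type*} (G : Digraph V) (r z : ℕ) : Prop :=
  ∀ v : V, undirDegree G v = r ∧ outDegree G v = z ∧ inDegree G v = z

/-- The vertices split into two classes such that every edge or arc joins vertices of different
classes.  (In particular there are no loops.) -/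
def IsBipartite {V : Type*} (G : Digraph V) : Prop :=
  ∃ c : V → Bool, ∀ u v : V, G.Adj u v → c u ≠ c v

/-- There is a walk of length `n` from `u` to `v`, respecting the directions of the arcs. -/
def HasWalk {V : Type*} (G : Digraph V) : ℕ → V → V → Prop
  | 0, u, v => u = v
  | n + 1, u, v => ∃ w : V, G.Adj u w ∧ HasWalk G n w v

/-- The distance from `u` to `v`; it is `⊤` when `v` cannot be reached from `u`. -/
noncomputable def edist {V : Type*} (G : Digraph V) (u v : V) : ℕ∞ :=
  ⨅ (n : ℕ) (_ : HasWalk G n u v), (n : ℕ∞)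

/-- The diameter: the maximum of the distances; it is `⊤` when some distance is infinite. -/
noncomputable def ediam {V : Type*} (G : Digraph V) : ℕ∞ :=
  ⨆ (u : V) (v : V), edist G u v

/-- A graph seen as a symmetric digraph: each edge is replaced by two opposite arcs. -/
def symmDigraph {V : Type*} (B : SimpleGraph V) : Digraph V where
  Adj u v := B.Adj u v

/-- The vertex set of the line digraph of `G`: the arcs of the digraph `G`. -/
abbrev ArcSet {V : Type*} (G : Digraph V) : Type _ := {a : V × V // G.Adj a.1 a.2}

/-- The line digraph of `G`: its vertices are the arcs of `G`, and the arc `(u, v)` is adjacent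
to the arc `(u', v')` if and only if `v = u'`. -/
def lineDigraph {V : Type*} (G : Digraph V) : Digraph (ArcSet G) where
  Adj a b := a.1.2 = b.1.1

/-- The Moore bound for bipartite graphs of degree `Δ ≥ 1` and diameter `D ≥ 1`, namely
`1 + Δ + Δ (Δ - 1) + ⋯ + Δ (Δ - 1) ^ (D - 2) + (Δ - 1) ^ (D - 1)`, which equals
`2 (1 + (Δ - 1) + ⋯ + (Δ - 1) ^ (D - 1))`. -/
def mooreBoundBip (Δ D : ℕ) : ℕ :=
  2 * ∑ i ∈ Finset.range D, (Δ - 1) ^ i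

/-- `B` is a Moore bipartite graph of degree `Δ` and diameter `D`: a bipartite graph, regular of
degree `Δ`, with diameter `D`, whose order attains the Moore bound. -/
structure IsMooreBipartite {V : Type*} (B : SimpleGraph V) (Δ D : ℕ) : Prop where
  finite : Finite V
  bipartite : B.IsBipartite
  regular : ∀ v : V, (B.neighborSet v).ncard = Δ
  diam : B.ediam = (D : ℕ∞)
  order : Nat.card V = mooreBoundBip Δ D

/-- The Moore bound for bipartite mixed graphs with undirected degree `r > 0`, directed out-degree
`z` and diameter `k`, with `d = r + z`. -/
noncomputable def mooreBoundMixed (r z k : ℕ) : ℝ :=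
  let d : ℝ := (r : ℝ) + (z : ℝ)
  let v : ℝ := (d - 1) ^ 2 + 4 * (z : ℝ)
  let u₁ : ℝ := (d - 1 - Real.sqrt v) / 2
  let u₂ : ℝ := (d - 1 + Real.sqrt v) / 2
  let A : ℝ := (Real.sqrt v - (d + 1)) / (2 * Real.sqrt v)
  let B : ℝ := (Real.sqrt v + (d + 1)) / (2 * Real.sqrt v)
  2 * (A * ((u₁ ^ (k + 1) - u₁) / (u₁ ^ 2 - 1)) + B * ((u₂ ^ (k + 1) - u₂) / (u₂ ^ 2 - 1)))

end BipMixed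

/-! Line digraphs of Moore bipartite graphs, and the existence of the latter.

For the line digraph, the vertices are the arcs of the graph. The only digon at the arc `(u, v)` is
the one with `(v, u)`, a walk of length `n + 1` between two arcs is a walk of length `n` from the
head of the first to the tail of the second (`hasWalk_lineDigraph_succ_iff`), and the arcs are
coloured by their tails; this gives the degrees, the diameter and the bipartition. For the
asymptotics, both the order and the Moore bound are equivalent to `2 z ^ D`: the larger root `u₂` is
equivalent to `z`, and the smaller root `u₁`, although it tends to the pole `-1` of its term,
contributes a bounded amount (`abs_small_root_term_le`).

The Moore bipartite graphs of diameter `3`, `4`, `6` are the incidence graphs of the classical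
generalized triangles, quadrangles and hexagons over a field with `q` elements. All three are
obtained from a bilinear map `m : V × V → W`, as the geometry of the totally isotropic subspaces of
dimensions `1` (points) and `2` (lines):
* `m = 0` on `F ^ 3`, the projective plane;
* the symplectic form on `F ^ 4`, the symplectic quadrangle;
* `m (x, y) = (x y, y x)` on the split octonions, the split Cayley hexagon.

In each case the vectors orthogonal to a given isotropic vector `x ≠ 0` form a space of dimension `3`
consisting of isotropic vectors (`IsUniform`), so that there are `q + 1` lines on a point, as there
are `q + 1` points on a line; and the number of isotropic vectors is `q ^ D`, which gives the number
`1 + q + ⋯ + q ^ (D - 1)` of points and, by double counting, of lines. It remains to determine the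
diameter. On a line there is always a nonzero vector `y` on which a given linear functional vanishes.
In the quadrangle, applied to the form `m x`, this puts `x` at distance at most `3` from the line. In
the hexagon, applied to `y ↦ tr (x y)`, it yields a `y` such that `x y` is zero or again isotropic;
then `x (x y) = 0 = (x y) y` by alternativity, so that `x y` is collinear with `x` and `y`, and `x`
is at distance at most `5` from the line. Explicit vertices show that these bounds are attained. The
octonion identities are checked in the coordinates of Zorn's vector matrices, and hold in every
characteristic. -/

namespace BipMixed

/-! ### Line digraphs of regular bipartite graphs -/

section LineDigraph

variable {V : Type*} (B : SimpleGraph V)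

theorem hasWalk_symmDigraph_iff (n : ℕ) (u v : V) :
    HasWalk (symmDigraph B) n u v ↔ ∃ p : B.Walk u v, p.length = n := by
  induction n generalizing u with
  | zero =>
    constructor
    · rintro rfl
      exact ⟨.nil, rfl⟩
    · rintro ⟨p, hp⟩
      exact SimpleGraph.Walk.eq_of_length_eq_zero hp
  | succ n ih =>
    constructor
    · rintro ⟨w, h, hw⟩
      obtain ⟨p, hp⟩ := (ih w).1 hw
      have h' : B.Adj u w := h
      exact ⟨.cons h' p, by rw [SimpleGraph.Walk.length_cons, hp]⟩
    · rintro ⟨p, hp⟩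
      cases p with
      | nil => simp at hp
      | cons h p => exact ⟨_, h, (ih _).2 ⟨p, by simpa using hp⟩⟩

/-- A walk of length `n + 1` between two arcs in the line digraph is a walk of length `n` from
the head of the first arc to the tail of the second. -/
theorem hasWalk_lineDigraph_succ_iff (G : Digraph V) (n : ℕ) (a b : ArcSet G) :
    HasWalk (lineDigraph G) (n + 1) a b ↔ HasWalk G n a.1.2 b.1.1 := by
  induction n generalizing a with
  | zero =>
    constructor
    · rintro ⟨w, h, rfl⟩
      exact h
    · intro h
      exact ⟨b, h, rfl⟩
  | succ n ih =>
    constructor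
    · rintro ⟨w, h, hw⟩
      have h' : a.1.2 = w.1.1 := h
      exact ⟨w.1.2, h' ▸ w.2, (ih w).1 hw⟩
    · rintro ⟨x, h, hw⟩
      exact ⟨⟨(a.1.2, x), h⟩, rfl, (ih _).2 hw⟩

theorem isBipartite_lineDigraph (hB : B.IsBipartite) :
    IsBipartite (lineDigraph (symmDigraph B)) := by
  obtain ⟨c⟩ := hB
  refine ⟨fun a => decide (c a.1.1 = 0), fun a b hab => ?_⟩
  have h1 : c a.1.1 ≠ c a.1.2 := c.valid a.2
  have h2 : a.1.2 = b.1.1 := hab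
  rw [h2] at h1
  simp only [ne_eq, decide_eq_decide]
  generalize c a.1.1 = i at *
  generalize c b.1.1 = j at *
  fin_cases i <;> fin_cases j <;> simp_all

/-- The arc `(u, v)` lies in exactly one digon, with the reversed arc `(v, u)`; the other `z` arcs
out of `v` and the other `z` arcs into `u` give its out- and in-neighbours. -/
theorem isTotallyRegular_lineDigraph [Finite V] {z : ℕ}
    (hB : ∀ v, (B.neighborSet v).ncard = z + 1) :
    IsTotallyRegular (lineDigraph (symmDigraph B)) 1 z := by
  rintro ⟨⟨u, v⟩, huv⟩
  have huv' : B.Adj u v := huv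
  refine ⟨?_, ?_, ?_⟩
  · rw [undirDegree, Set.ncard_eq_one]
    refine ⟨⟨(v, u), huv'.symm⟩, ?_⟩
    ext ⟨⟨x, y⟩, hxy⟩
    simp only [lineDigraph, Set.mem_ofPred_eq, Set.mem_singleton_iff]
    grind
  · have h : (B.neighborSet v \ {u}).ncard = z := by
      rw [Set.ncard_sdiff_singleton_of_mem (by simpa using huv'.symm), hB]; rfl
    rw [outDegree, ← h]
    symm
    refine Set.ncard_congr (fun w hw => ⟨(v, w), hw.1⟩) ?_ ?_ ?_
    · rintro w ⟨hw, hwu⟩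
      exact ⟨rfl, hwu⟩
    · intro w w' _ _ h
      exact congrArg (fun c : ArcSet (symmDigraph B) => c.1.2) h
    · rintro ⟨⟨x, y⟩, hxy⟩ ⟨h1, h2⟩
      have h1' : v = x := h1
      subst h1'
      exact ⟨y, ⟨hxy, h2⟩, rfl⟩
  · have h : (B.neighborSet u \ {v}).ncard = z := by
      rw [Set.ncard_sdiff_singleton_of_mem (by simpa using huv'), hB]; rfl
    rw [inDegree, ← h]
    symm
    refine Set.ncard_congr (fun w hw => ⟨(w, u), hw.1.symm⟩) ?_ ?_ ?_
    · rintro w ⟨hw, hwu⟩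
      exact ⟨rfl, fun h => hwu (Eq.symm h)⟩
    · intro w w' _ _ h
      exact congrArg (fun c : ArcSet (symmDigraph B) => c.1.1) h
    · rintro ⟨⟨x, y⟩, hxy⟩ ⟨h1, h2⟩
      have h1' : y = u := h1
      subst h1'
      exact ⟨x, ⟨SimpleGraph.Adj.symm hxy, fun h => h2 (Eq.symm h)⟩, rfl⟩

theorem card_arcSet [Finite V] {d : ℕ} (hB : ∀ v, (B.neighborSet v).ncard = d) :
    Nat.card (ArcSet (symmDigraph B)) = Nat.card V * d := by
  have := Fintype.ofFinite V
  let e : ArcSet (symmDigraph B) ≃ Σ v : V, B.neighborSet v :=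
    { toFun := fun a => ⟨a.1.1, a.1.2, a.2⟩
      invFun := fun s => ⟨(s.1, s.2.1), s.2.2⟩
      left_inv := fun _ => rfl
      right_inv := fun _ => rfl }
  rw [Nat.card_congr e, Nat.card_sigma]
  simp [hB, Nat.card_coe_set_eq]

theorem IsMooreBipartite.card_arcSet {B : SimpleGraph V} {z D : ℕ}
    (hB : IsMooreBipartite B (z + 1) D) :
    Nat.card (ArcSet (symmDigraph B)) = 2 * (z + 1) * ∑ i ∈ Finset.range D, z ^ i := by
  have := hB.finite
  rw [BipMixed.card_arcSet B hB.regular, hB.order, mooreBoundBip]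
  simp only [Nat.add_sub_cancel]
  ring

/-- Passing to the line digraph increases the diameter by one. For `a = (u', u)` and `b = (v, v')`
with `u` and `v` at distance `D`, the hypothesis `2 ≤ D` excludes `a = b`. -/
theorem ediam_lineDigraph [Finite V] {D : ℕ} (hD : 2 ≤ D)
    (hnb : ∀ v, ∃ w, B.Adj v w) (hdiam : B.ediam = D) :
    ediam (lineDigraph (symmDigraph B)) = ((D + 1 : ℕ) : ℕ∞) := by
  have : Nonempty V := by
    by_contra h
    rw [not_nonempty_iff] at h
    have : B.ediam = 0 := by simp [SimpleGraph.ediam_eq_zero_of_subsingleton]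
    rw [this] at hdiam
    have : 0 = D := by exact_mod_cast hdiam
    omega
  apply le_antisymm
  · refine iSup₂_le fun a b => ?_
    have h : B.edist a.1.2 b.1.1 ≤ D := hdiam ▸ SimpleGraph.edist_le_ediam
    have hne : B.edist a.1.2 b.1.1 ≠ ⊤ := ne_top_of_le_ne_top (ENat.natCast_ne_top D) h
    obtain ⟨p, hp⟩ := SimpleGraph.exists_walk_of_edist_ne_top hne
    have hw := (hasWalk_lineDigraph_succ_iff (symmDigraph B) p.length a b).2
      ((hasWalk_symmDigraph_iff B _ _ _).2 ⟨p, rfl⟩)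
    have hle : edist (lineDigraph (symmDigraph B)) a b ≤ ((p.length + 1 : ℕ) : ℕ∞) :=
      iInf₂_le (f := fun n (_ : HasWalk (lineDigraph (symmDigraph B)) n a b) => (n : ℕ∞)) _ hw
    refine hle.trans ?_
    rw [← hp] at h
    have : p.length ≤ D := by exact_mod_cast h
    exact_mod_cast Nat.succ_le_succ this
  · obtain ⟨u, v, huv⟩ := B.exists_edist_eq_ediam_of_finite
    rw [hdiam] at huv
    obtain ⟨u', hu'⟩ := hnb u
    obtain ⟨v', hv'⟩ := hnb v
    let a : ArcSet (symmDigraph B) := ⟨(u', u), hu'.symm⟩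
    let b : ArcSet (symmDigraph B) := ⟨(v, v'), hv'⟩
    refine le_trans ?_ (le_iSup₂ (f := fun u v => edist (lineDigraph (symmDigraph B)) u v) a b)
    refine le_iInf₂ fun n hn => ?_
    cases n with
    | zero =>
      have hab : a = b := hn
      have h1 : u' = v := congrArg (fun c => c.1.1) hab
      subst h1
      have h2 : B.edist u u' ≤ 1 := by simpa using SimpleGraph.edist_le hu'.toWalk
      rw [huv] at h2
      have : D ≤ 1 := by exact_mod_cast h2
      omega
    | succ n =>
      obtain ⟨p, hp⟩ := (hasWalk_symmDigraph_iff B _ _ _).1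
        ((hasWalk_lineDigraph_succ_iff _ n a b).1 hn)
      have h2 : B.edist u v ≤ p.length := SimpleGraph.edist_le p
      rw [huv, hp] at h2
      have : D ≤ n := by exact_mod_cast h2
      exact_mod_cast Nat.succ_le_succ this

end LineDigraph

/-! ### Asymptotics of the Moore bound -/

section Asymptotics

open Filter Topology

/-- The contribution of the root `u₁` to the Moore bound stays bounded as `z → ∞`: writing
`u₁ = -t` with `t = z / u₂ ∈ (0, 1)`, the denominator satisfies
`1 - u₁ ^ 2 ≥ 1 - t = z / u₂ ^ 2 ≥ z / (z + 1) ^ 2`, while `|A| ≤ 1 / z`. -/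
theorem abs_small_root_term_le {z s : ℝ} (n : ℕ) (hz : 1 ≤ z) (hs : 0 ≤ s)
    (hs2 : s ^ 2 = z ^ 2 + 4 * z) :
    |(s - (z + 2)) / (2 * s) *
      ((((z - s) / 2) ^ n - (z - s) / 2) / (((z - s) / 2) ^ 2 - 1))| ≤ 8 := by
  have h1 : z < s := by nlinarith
  have h2 : s < z + 2 := by nlinarith
  obtain ⟨t, ht⟩ : ∃ t, t = (s - z) / 2 := ⟨_, rfl⟩
  have hu : (z - s) / 2 = -t := by rw [ht]; ring
  have ht0 : 0 < t := by rw [ht]; linarith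
  have ht1 : t < 1 := by rw [ht]; linarith
  have ht2 : t * (t + z) = z := by rw [ht]; nlinarith
  have hden : z / (z + 1) ^ 2 ≤ 1 - t ^ 2 := by
    have h3 : z / (z + 1) ^ 2 ≤ 1 - t := by
      rw [div_le_iff₀ (by positivity)]
      have h4 : (1 - t) * (t + z) ^ 2 = z := by linear_combination (-(t + z) + 1) * ht2
      have h5 : (1 - t) * (t + z) ^ 2 ≤ (1 - t) * (z + 1) ^ 2 := by
        apply mul_le_mul_of_nonneg_left _ (by linarith)
        exact pow_le_pow_left₀ (by linarith) (by linarith) 2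
      linarith
    nlinarith
  have hd0 : 0 < z / (z + 1) ^ 2 := by positivity
  have hA : |(s - (z + 2)) / (2 * s)| ≤ 1 / z := by
    rw [abs_div, abs_of_neg (by linarith : s - (z + 2) < 0),
      abs_of_pos (by linarith : 0 < 2 * s)]
    rw [div_le_div_iff₀ (by linarith) (by linarith)]
    nlinarith
  have hnum : |(-t) ^ n - -t| ≤ 2 := by
    have h6 : |(-t) ^ n| ≤ 1 := by
      rw [abs_pow, abs_neg, abs_of_pos ht0]
      exact pow_le_one₀ ht0.le ht1.le
    have h7 := abs_le.1 h6
    rw [abs_le]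
    constructor <;> linarith
  rw [hu, abs_mul, abs_div ((-t) ^ n - -t)]
  have h8 : |(-t) ^ 2 - 1| = 1 - t ^ 2 := by
    rw [neg_sq, abs_of_nonpos (by linarith)]; ring
  rw [h8]
  calc _ ≤ 1 / z * (2 / (z / (z + 1) ^ 2)) := by
        apply mul_le_mul hA _ (div_nonneg (abs_nonneg _) (by linarith)) (by positivity)
        exact div_le_div₀ (by norm_num) hnum hd0 hden
    _ = 2 * ((z + 1) / z) ^ 2 := by field_simp
    _ ≤ 2 * 2 ^ 2 := by
        have h9 : (z + 1) / z ≤ 2 := by rw [div_le_iff₀ (by linarith)]; linarith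
        gcongr
    _ = 8 := by norm_num

/-- The square root of the discriminant `v = z ^ 2 + 4 z` is asymptotic to `z`. -/
theorem tendsto_sqrt_div :
    Tendsto (fun z : ℕ => Real.sqrt ((z : ℝ) ^ 2 + 4 * z) / z) atTop (𝓝 1) := by
  have h : Tendsto (fun z : ℕ => Real.sqrt (1 + 4 * ((z : ℝ))⁻¹)) atTop
      (𝓝 (Real.sqrt (1 + 4 * 0))) :=
    ((tendsto_inv_atTop_nhds_zero_nat.const_mul 4).const_add 1).sqrt
  simp only [mul_zero, add_zero, Real.sqrt_one] at h
  refine h.congr' ?_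
  filter_upwards [eventually_gt_atTop 0] with z hz
  have hz' : (0 : ℝ) < z := by exact_mod_cast hz
  rw [show (1 : ℝ) + 4 * (z : ℝ)⁻¹ = ((z : ℝ) ^ 2 + 4 * z) / (z : ℝ) ^ 2 by field_simp,
    Real.sqrt_div (by positivity), Real.sqrt_sq hz'.le]

/-- The Moore bound is asymptotic to `2 z ^ D`: the root `u₂` contributes `B u₂ ^ (D + 2) / u₂ ^ 2`
with `B → 1` and `u₂ / z → 1`, and the contribution of `u₁` is bounded. -/
theorem tendsto_mooreBoundMixed (D : ℕ) (hD : 1 ≤ D) :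
    Tendsto (fun z : ℕ => mooreBoundMixed 1 z (D + 1) / (2 * (z : ℝ) ^ D)) atTop (𝓝 1) := by
  have hx : Tendsto (fun z : ℕ => ((z : ℝ))⁻¹) atTop (𝓝 0) := tendsto_inv_atTop_nhds_zero_nat
  have hs := tendsto_sqrt_div
  -- `u₂ / z → 1` and `B → 1`, written in terms of `s / z` and `1 / z`
  have hw := (hs.const_add 1).div_const 2
  have hB := (hs.add (((hx.const_mul 2).const_add 1))).div (hs.const_mul 2) (by norm_num)
  have hxp : Tendsto (fun z : ℕ => ((z : ℝ))⁻¹ ^ (D + 1)) atTop (𝓝 0) := by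
    simpa using hx.pow (D + 1)
  have h2 := hB.mul ((((hw.pow (D + 2)).sub (hw.mul hxp))).div ((hw.pow 2).sub (hx.pow 2))
    (by norm_num))
  have h1 : Tendsto (fun z : ℕ =>
      ((Real.sqrt ((z : ℝ) ^ 2 + 4 * z) - (z + 2)) / (2 * Real.sqrt ((z : ℝ) ^ 2 + 4 * z)) *
      (((((z : ℝ) - Real.sqrt ((z : ℝ) ^ 2 + 4 * z)) / 2) ^ (D + 2) -
        ((z : ℝ) - Real.sqrt ((z : ℝ) ^ 2 + 4 * z)) / 2) /
        ((((z : ℝ) - Real.sqrt ((z : ℝ) ^ 2 + 4 * z)) / 2) ^ 2 - 1))) * (z : ℝ)⁻¹ ^ D)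
      atTop (𝓝 0) := by
    have hxD : Tendsto (fun z : ℕ => 8 * ((z : ℝ))⁻¹ ^ D) atTop (𝓝 0) := by
      simpa [show D ≠ 0 by omega] using (hx.pow D).const_mul 8
    refine squeeze_zero_norm' ?_ hxD
    filter_upwards [eventually_ge_atTop 1] with z hz
    have hz' : (1 : ℝ) ≤ z := by exact_mod_cast hz
    rw [norm_mul, Real.norm_eq_abs, Real.norm_of_nonneg (by positivity : 0 ≤ (z : ℝ)⁻¹ ^ D)]
    exact mul_le_mul_of_nonneg_right
      (abs_small_root_term_le (D + 2) hz' (Real.sqrt_nonneg _) (Real.sq_sqrt (by positivity)))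
      (by positivity)
  have h := h1.add h2
  rw [show (0 : ℝ) + (1 + (1 + 2 * 0)) / (2 * 1) * ((((1 + 1) / 2) ^ (D + 2) - (1 + 1) / 2 * 0) /
    (((1 + 1) / 2) ^ 2 - 0 ^ 2)) = 1 by norm_num] at h
  refine h.congr' ?_
  filter_upwards [eventually_ge_atTop 1] with z hz
  have hz' : (1 : ℝ) ≤ z := by exact_mod_cast hz
  have hz0 : (z : ℝ) ≠ 0 := by positivity
  have hd : ((1 : ℕ) : ℝ) + (z : ℝ) - 1 = z := by push_cast; ring
  have hd' : ((1 : ℕ) : ℝ) + (z : ℝ) + 1 = z + 2 := by push_cast; ring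
  simp only [Pi.div_apply, mooreBoundMixed, hd, hd']
  have hs2 : Real.sqrt ((z : ℝ) ^ 2 + 4 * z) ^ 2 = (z : ℝ) ^ 2 + 4 * z :=
    Real.sq_sqrt (by positivity)
  have hs0 : 0 ≤ Real.sqrt ((z : ℝ) ^ 2 + 4 * z) := Real.sqrt_nonneg _
  generalize Real.sqrt ((z : ℝ) ^ 2 + 4 * z) = s at *
  have hsz : z < s := by nlinarith
  have hsp : 0 < s := by linarith
  rw [mul_div_mul_left _ _ two_ne_zero, add_div _ _ ((z : ℝ) ^ D)]
  congr 1
  · rw [inv_pow, div_eq_mul_inv _ ((z : ℝ) ^ D)]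
  · have hw : ((z : ℝ) + s) / 2 = z * ((1 + s / z) / 2) := by field_simp
    have hB : (s / z + (1 + 2 * (z : ℝ)⁻¹)) / (2 * (s / z)) = (s + (z + 2)) / (2 * s) := by
      field_simp
    have hw1 : 1 < (1 + s / z) / 2 := by
      have : 1 < s / z := by rwa [one_lt_div (by linarith)]
      linarith
    rw [hw, hB, mul_div_assoc]
    generalize (1 + s / z) / 2 = w at *
    have hden : ((z : ℝ) * w) ^ 2 - 1 ≠ 0 := by
      have : 1 < (z : ℝ) * w := by nlinarith
      nlinarith
    have hden' : w ^ 2 - (z : ℝ)⁻¹ ^ 2 = (((z : ℝ) * w) ^ 2 - 1) / z ^ 2 := by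
      field_simp
    congr 1
    rw [hden', inv_pow]
    field_simp
    ring

theorem tendsto_order (D : ℕ) (hD : 1 ≤ D) :
    Tendsto (fun z : ℕ => (((2 * (z + 1) * ∑ i ∈ Finset.range D, z ^ i : ℕ)) : ℝ) /
      (2 * (z : ℝ) ^ D)) atTop (𝓝 1) := by
  have hx : Tendsto (fun z : ℕ => ((z : ℝ))⁻¹) atTop (𝓝 0) := tendsto_inv_atTop_nhds_zero_nat
  have h := ((hx.const_add 1).div (hx.const_sub 1) (by norm_num)).mul ((hx.pow D).const_sub 1)
  have hD0 : D ≠ 0 := by omega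
  simp only [add_zero, sub_zero, zero_pow hD0, div_one, mul_one] at h
  refine h.congr' ?_
  filter_upwards [eventually_ge_atTop 2] with z hz
  have hz' : (2 : ℝ) ≤ z := by exact_mod_cast hz
  have hz0 : (z : ℝ) ≠ 0 := by positivity
  have hz1 : (z : ℝ) - 1 ≠ 0 := by linarith
  push_cast
  rw [geom_sum_eq (by linarith)]
  simp only [Pi.div_apply]
  have h3 : (1 : ℝ) - (z : ℝ)⁻¹ = (z - 1) / z := by field_simp
  rw [h3, inv_pow]
  field_simp

/-- Both the order and the Moore bound are asymptotic to `2 z ^ D`. -/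
theorem tendsto_order_div_mooreBoundMixed (D : ℕ) (hD : 1 ≤ D) :
    Tendsto (fun z : ℕ => (((2 * (z + 1) * ∑ i ∈ Finset.range D, z ^ i : ℕ)) : ℝ) /
      mooreBoundMixed 1 z (D + 1)) atTop (𝓝 1) := by
  have h := (tendsto_order D hD).div (tendsto_mooreBoundMixed D hD) one_ne_zero
  rw [div_one] at h
  refine h.congr' ?_
  filter_upwards [eventually_ge_atTop 1] with z hz
  have hz0 : (z : ℝ) ≠ 0 := by positivity
  simp only [Pi.div_apply]
  rw [div_div_div_cancel_right₀ (by positivity)]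

end Asymptotics

/-! ### Counting subspaces over a finite field -/

theorem card_eq_mul_of_card_fiber {α β : Type*} [Finite α] [Finite β] (f : α → β) (c : ℕ)
    (h : ∀ b, Nat.card {a // f a = b} = c) : Nat.card α = Nat.card β * c := by
  have := Fintype.ofFinite β
  rw [← Nat.card_congr (Equiv.sigmaFiberEquiv f), Nat.card_sigma]
  simp [h]

section Subspaces

open Module

variable {F V : Type*} [Field F] [Finite F] [AddCommGroup V] [Module F V] [Module.Finite F V]

theorem card_mem_and_notMem {A K : Submodule F V} (hAK : A ≤ K) :
    Nat.card {y : V // y ∈ K ∧ y ∉ A} =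
      Nat.card F ^ finrank F K - Nat.card F ^ finrank F A := by
  have : Finite V := Module.finite_of_finite F
  rw [← Module.natCard_eq_pow_finrank, ← Module.natCard_eq_pow_finrank]
  have h := Set.ncard_sdiff (show (A : Set V) ⊆ K from hAK)
  exact h

/-- Between subspaces of dimensions `a` and `a + 2` there are exactly `q + 1` of dimension `a + 1`:
the `q ^ (a + 2) - q ^ a` vectors outside the small one are divided into classes of size
`q ^ (a + 1) - q ^ a`. -/
theorem card_intermediate {A K : Submodule F V} (hAK : A ≤ K)
    (hr : finrank F K = finrank F A + 2) :
    Nat.card {B : Submodule F V // A ≤ B ∧ B ≤ K ∧ finrank F B = finrank F A + 1} =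
      Nat.card F + 1 := by
  have : Finite V := Module.finite_of_finite F
  have : Finite (Submodule F V) := Finite.of_injective _ SetLike.coe_injective
  let f : {y : V // y ∈ K ∧ y ∉ A} →
      {B : Submodule F V // A ≤ B ∧ B ≤ K ∧ finrank F B = finrank F A + 1} :=
    fun y => ⟨A ⊔ F ∙ y.1, le_sup_left,
      sup_le hAK ((Submodule.span_singleton_le_iff_mem _ _).2 y.2.1),
      Submodule.finrank_sup_span_singleton y.2.2⟩
  have hfib : ∀ B, Nat.card {y // f y = B} =
      Nat.card F ^ (finrank F A + 1) - Nat.card F ^ finrank F A := by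
    rintro ⟨B, hAB, hBK, hB⟩
    have hcard := card_mem_and_notMem hAB
    rw [hB] at hcard
    rw [← hcard]
    refine Nat.card_congr
      { toFun := fun y => ⟨y.1.1, ?_, y.1.2.2⟩
        invFun := fun y => ⟨⟨y.1, hBK y.2.1, y.2.2⟩, ?_⟩
        left_inv := fun _ => rfl
        right_inv := fun _ => rfl }
    · have h := congrArg Subtype.val y.2
      change A ⊔ F ∙ y.1.1 = B at h
      exact h.le (Submodule.mem_sup_right (Submodule.mem_span_singleton_self _))
    · apply Subtype.ext
      change A ⊔ F ∙ y.1 = B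
      apply Submodule.eq_of_le_of_finrank_eq
      · exact sup_le hAB ((Submodule.span_singleton_le_iff_mem _ _).2 y.2.1)
      · rw [Submodule.finrank_sup_span_singleton y.2.2, hB]
  have h := card_eq_mul_of_card_fiber f _ hfib
  rw [card_mem_and_notMem hAK, hr] at h
  have hq : 1 < Nat.card F := Finite.one_lt_card
  obtain ⟨c, hc⟩ : ∃ c, Nat.card F = c + 1 := ⟨Nat.card F - 1, by omega⟩
  have hc0 : 0 < c := by omega
  have e1 : Nat.card F ^ (finrank F A + 1) - Nat.card F ^ finrank F A =
      Nat.card F ^ finrank F A * c := by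
    rw [Nat.sub_eq_iff_eq_add (Nat.pow_le_pow_right (by omega) (by omega)), pow_succ]
    nth_rw 2 [hc]; ring
  have e2 : Nat.card F ^ (finrank F A + 2) - Nat.card F ^ finrank F A =
      (Nat.card F + 1) * (Nat.card F ^ finrank F A * c) := by
    rw [Nat.sub_eq_iff_eq_add (Nat.pow_le_pow_right (by omega) (by omega)), pow_add]
    nth_rw 2 [hc]; nth_rw 2 [hc]; ring
  rw [e1, e2] at h
  exact (Nat.eq_of_mul_eq_mul_right (by positivity) h).symm

end Subspaces

/-! ### The geometry of totally isotropic points and lines -/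

section Geometry

open Module

variable {F V W : Type*} [Field F] [AddCommGroup V] [Module F V] [AddCommGroup W] [Module F W]

/-- A subspace on which the bilinear map `m` vanishes identically. -/
def IsTotallyIsotropic (m : V →ₗ[F] V →ₗ[F] W) (U : Submodule F V) : Prop :=
  ∀ x ∈ U, ∀ y ∈ U, m x y = 0

/-- The points (dimension `1`) and lines (dimension `2`) of the geometry of totally isotropic
subspaces of a bilinear map. -/
abbrev Flat (m : V →ₗ[F] V →ₗ[F] W) : Type _ :=
  {U : Submodule F V // (finrank F U = 1 ∨ finrank F U = 2) ∧ IsTotallyIsotropic m U}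

/-- The incidence graph of the totally isotropic points and lines: incidence is strict inclusion,
in either direction. -/
def incidenceGraph (m : V →ₗ[F] V →ₗ[F] W) : SimpleGraph (Flat m) where
  Adj P Q := P.1 < Q.1 ∨ Q.1 < P.1
  symm := ⟨fun _ _ h => h.symm⟩
  loopless := ⟨fun _ h => by simp at h⟩

/-- The local condition which makes the geometry of totally isotropic points and lines uniform:
orthogonality to an isotropic vector is symmetric, implies isotropy, and defines a space of
dimension `3`. -/
structure IsUniform (m : V →ₗ[F] V →ₗ[F] W) : Prop where
  finrank_ker : ∀ x, x ≠ 0 → m x x = 0 → finrank F (LinearMap.ker (m x)) = 3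
  isotropic : ∀ x y, x ≠ 0 → m x x = 0 → m x y = 0 → m y y = 0
  symm : ∀ x y, x ≠ 0 → m x x = 0 → m x y = 0 → m y x = 0

variable [Module.Finite F V] {m : V →ₗ[F] V →ₗ[F] W}

theorem incidenceGraph_adj_iff {P Q : Flat m} : (incidenceGraph m).Adj P Q ↔
    (finrank F P.1 = 1 ∧ finrank F Q.1 = 2 ∧ P.1 ≤ Q.1) ∨
    (finrank F P.1 = 2 ∧ finrank F Q.1 = 1 ∧ Q.1 ≤ P.1) := by
  constructor
  · rintro (h | h)
    · have h1 := Submodule.finrank_lt_finrank_of_lt h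
      have := P.2.1
      have := Q.2.1
      exact .inl ⟨by omega, by omega, h.le⟩
    · have h1 := Submodule.finrank_lt_finrank_of_lt h
      have := P.2.1
      have := Q.2.1
      exact .inr ⟨by omega, by omega, h.le⟩
  · rintro (⟨h1, h2, h3⟩ | ⟨h1, h2, h3⟩)
    · refine .inl (lt_of_le_of_ne h3 fun h => ?_)
      rw [h] at h1; omega
    · refine .inr (lt_of_le_of_ne h3 fun h => ?_)
      rw [h] at h2; omega

variable (m) in
/-- The colouring of the points and the lines by their type. -/
noncomputable def typeColoring : (incidenceGraph m).Coloring Bool :=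
  SimpleGraph.Coloring.mk (fun P => decide (finrank F P.1 = 1)) fun {P Q} h => by
    rcases incidenceGraph_adj_iff.1 h with ⟨h1, h2, -⟩ | ⟨h1, h2, -⟩ <;> simp [h1, h2]

/-- The point spanned by an isotropic vector. -/
def point (x : V) (hx : x ≠ 0) (hxx : m x x = 0) : Flat m :=
  ⟨F ∙ x, .inl (finrank_span_singleton hx), fun y hy z hz => by
    obtain ⟨a, rfl⟩ := Submodule.mem_span_singleton.1 hy
    obtain ⟨b, rfl⟩ := Submodule.mem_span_singleton.1 hz
    simp [hxx]⟩

theorem exists_eq_point (P : Flat m) (hP : finrank F P.1 = 1) :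
    ∃ (x : V) (hx : x ≠ 0) (hxx : m x x = 0), P = point x hx hxx := by
  obtain ⟨x, hx, h⟩ := finrank_eq_one_iff'.1 hP
  have hx0 : (x : V) ≠ 0 := by simpa using hx
  refine ⟨x, hx0, P.2.2 _ x.2 _ x.2, Subtype.ext ?_⟩
  symm
  apply Submodule.eq_of_le_of_finrank_eq
  · exact (Submodule.span_singleton_le_iff_mem _ _).2 x.2
  · exact (finrank_span_singleton hx0).trans hP.symm

theorem adj_point_iff {x : V} {hx : x ≠ 0} {hxx : m x x = 0} {L : Flat m} :
    (incidenceGraph m).Adj (point x hx hxx) L ↔ finrank F L.1 = 2 ∧ x ∈ L.1 := by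
  have h1 : finrank F (point x hx hxx : Flat m).1 = 1 := finrank_span_singleton hx
  rw [incidenceGraph_adj_iff, h1]
  have : (point x hx hxx : Flat m).1 = F ∙ x := rfl
  rw [this, Submodule.span_singleton_le_iff_mem]
  simp

/-- The totally isotropic subspaces of dimension `2` through an isotropic vector `x` are the
subspaces of dimension `2` between `⟨x⟩` and the kernel of `m x`. -/
theorem IsUniform.isTotallyIsotropic_iff (hm : IsUniform m) {x : V} (hx : x ≠ 0)
    (hxx : m x x = 0) {U : Submodule F V} (hU : finrank F U = 2) (hxU : x ∈ U) :
    IsTotallyIsotropic m U ↔ U ≤ LinearMap.ker (m x) := by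
  refine ⟨fun h y hy => h x hxU y hy, fun h y hy z hz => ?_⟩
  by_cases hyx : y ∈ F ∙ x
  · obtain ⟨a, rfl⟩ := Submodule.mem_span_singleton.1 hyx
    have := h hz
    rw [LinearMap.mem_ker] at this
    simp [this]
  · have hle : F ∙ x ⊔ F ∙ y = U := by
      apply Submodule.eq_of_le_of_finrank_eq
      · exact sup_le ((Submodule.span_singleton_le_iff_mem _ _).2 hxU)
          ((Submodule.span_singleton_le_iff_mem _ _).2 hy)
      · rw [Submodule.finrank_sup_span_singleton hyx, finrank_span_singleton hx, hU]
    rw [← hle] at hz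
    obtain ⟨b, hb, c, hc, rfl⟩ := Submodule.mem_sup.1 hz
    obtain ⟨b, rfl⟩ := Submodule.mem_span_singleton.1 hb
    obtain ⟨c, rfl⟩ := Submodule.mem_span_singleton.1 hc
    have h1 : m x y = 0 := h hy
    simp [hm.symm x y hx hxx h1, hm.isotropic x y hx hxx h1]

/-- Two orthogonal isotropic vectors lie on a common line. -/
theorem IsUniform.edist_point_point_le_two (hm : IsUniform m) {x y : V} {hx : x ≠ 0}
    {hxx : m x x = 0} {hy : y ≠ 0} {hyy : m y y = 0} (hxy : m x y = 0) :
    (incidenceGraph m).edist (point x hx hxx) (point y hy hyy) ≤ 2 := by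
  by_cases hyx : y ∈ F ∙ x
  · have : (point y hy hyy : Flat m) = point x hx hxx := by
      apply Subtype.ext
      apply Submodule.eq_of_le_of_finrank_eq
      · exact (Submodule.span_singleton_le_iff_mem _ _).2 hyx
      · exact (finrank_span_singleton hy).trans (finrank_span_singleton hx).symm
    rw [this]
    simp
  · have h2 : finrank F (F ∙ x ⊔ F ∙ y : Submodule F V) = 2 := by
      rw [Submodule.finrank_sup_span_singleton hyx, finrank_span_singleton hx]
    have hxU : x ∈ (F ∙ x ⊔ F ∙ y : Submodule F V) :=
      Submodule.mem_sup_left (Submodule.mem_span_singleton_self x)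
    have hyU : y ∈ (F ∙ x ⊔ F ∙ y : Submodule F V) :=
      Submodule.mem_sup_right (Submodule.mem_span_singleton_self y)
    let L : Flat m := ⟨F ∙ x ⊔ F ∙ y, .inr h2, (hm.isTotallyIsotropic_iff hx hxx h2 hxU).2
      (sup_le ((Submodule.span_singleton_le_iff_mem _ _).2 hxx)
        ((Submodule.span_singleton_le_iff_mem _ _).2 hxy))⟩
    have hxL : (incidenceGraph m).Adj (point x hx hxx) L := adj_point_iff.2 ⟨h2, hxU⟩
    have hyL : (incidenceGraph m).Adj (point y hy hyy) L := adj_point_iff.2 ⟨h2, hyU⟩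
    exact SimpleGraph.edist_le (.cons hxL (.cons hyL.symm .nil))

/-- A walk of length at least `2` from a point starts by moving along a line to an orthogonal
point. -/
theorem exists_orthogonal_of_walk {x : V} {hx : x ≠ 0} {hxx : m x x = 0} {Q : Flat m} {n : ℕ}
    (p : (incidenceGraph m).Walk (point x hx hxx) Q) (hp : p.length = n + 2) :
    ∃ (y : V) (hy : y ≠ 0) (hyy : m y y = 0) (p' : (incidenceGraph m).Walk (point y hy hyy) Q),
      m x y = 0 ∧ p'.length = n := by
  cases p with
  | nil => simp at hp
  | @cons _ L _ h p =>
    cases p with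
    | nil => simp at hp
    | @cons _ R _ h' p =>
      obtain ⟨hL, hxL⟩ := adj_point_iff.1 h
      rcases incidenceGraph_adj_iff.1 h' with ⟨h1, -, -⟩ | ⟨-, h2, hR⟩
      · omega
      · obtain ⟨y, hy, hyy, rfl⟩ := exists_eq_point R h2
        refine ⟨y, hy, hyy, p, ?_, by simpa using hp⟩
        exact L.2.2 x hxL y (hR (Submodule.mem_span_singleton_self y))

theorem even_length_of_walk {x y : V} {hx : x ≠ 0} {hxx : m x x = 0} {hy : y ≠ 0}
    {hyy : m y y = 0} (p : (incidenceGraph m).Walk (point x hx hxx) (point y hy hyy)) :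
    Even p.length := by
  rw [(typeColoring m).even_length_iff_congr p]
  have h1 : finrank F (point x hx hxx : Flat m).1 = 1 := finrank_span_singleton hx
  have h2 : finrank F (point y hy hyy : Flat m).1 = 1 := finrank_span_singleton hy
  have h3 : ∀ P, typeColoring m P = decide (finrank F P.1 = 1) := fun _ => rfl
  simp [h3, h1, h2]

theorem edist_le_of_mem {x y : V} {hx : x ≠ 0} {hxx : m x x = 0} {hy : y ≠ 0} {hyy : m y y = 0}
    {L : Flat m} (hL : finrank F L.1 = 2) (hyL : y ∈ L.1) {n : ℕ}
    (h : (incidenceGraph m).edist (point x hx hxx) (point y hy hyy) ≤ n) :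
    (incidenceGraph m).edist (point x hx hxx) L ≤ ((n + 1 : ℕ) : ℕ∞) := by
  have h1 : (incidenceGraph m).edist (point y hy hyy) L ≤ 1 :=
    (SimpleGraph.edist_eq_one_iff_adj.2 (adj_point_iff.2 ⟨hL, hyL⟩)).le
  calc _ ≤ _ := SimpleGraph.edist_triangle (v := point y hy hyy)
    _ ≤ (n : ℕ∞) + 1 := add_le_add h h1
    _ = ((n + 1 : ℕ) : ℕ∞) := by push_cast; ring

/-- A linear functional vanishes at a nonzero vector of every line. -/
theorem exists_mem_line_map_eq_zero (φ : V →ₗ[F] F) (L : Submodule F V) (hL : finrank F L = 2) :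
    ∃ y ∈ L, y ≠ 0 ∧ φ y = 0 := by
  have h : LinearMap.ker (φ.domRestrict L) ≠ ⊥ :=
    LinearMap.ker_ne_bot_of_finrank_lt (by rw [hL, finrank_self]; omega)
  obtain ⟨y, hy, hy0⟩ := Submodule.exists_mem_ne_zero_of_ne_bot h
  exact ⟨y, y.2, by simpa using hy0, hy⟩

variable [Finite F]

instance : Finite (Flat m) := by
  have : Finite V := Module.finite_of_finite F
  have : Finite (Submodule F V) := Finite.of_injective _ SetLike.coe_injective
  exact Subtype.finite

/-- Every line has `q + 1` points, and every point is on `q + 1` lines. -/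
theorem IsUniform.ncard_neighborSet (hm : IsUniform m) (P : Flat m) :
    ((incidenceGraph m).neighborSet P).ncard = Nat.card F + 1 := by
  rw [← Nat.card_coe_set_eq]
  by_cases hP : finrank F P.1 = 1
  · obtain ⟨x, hx, hxx, rfl⟩ := exists_eq_point P hP
    have hle : F ∙ x ≤ LinearMap.ker (m x) := (Submodule.span_singleton_le_iff_mem _ _).2 hxx
    rw [← card_intermediate hle
      (by rw [hm.finrank_ker x hx hxx, finrank_span_singleton hx])]
    rw [finrank_span_singleton hx]
    refine Nat.card_congr
      { toFun := fun L => ⟨L.1.1, ?_, ?_, ?_⟩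
        invFun := fun B => ⟨⟨B.1, .inr B.2.2.2, ?_⟩, ?_⟩
        left_inv := fun _ => rfl
        right_inv := fun _ => rfl }
    · exact (Submodule.span_singleton_le_iff_mem _ _).2 (adj_point_iff.1 L.2).2
    · exact fun y hy => L.1.2.2 x (adj_point_iff.1 L.2).2 y hy
    · exact (adj_point_iff.1 L.2).1
    · exact (hm.isTotallyIsotropic_iff hx hxx B.2.2.2
        ((Submodule.span_singleton_le_iff_mem _ _).1 B.2.1)).2 B.2.2.1
    · exact adj_point_iff.2 ⟨B.2.2.2, (Submodule.span_singleton_le_iff_mem _ _).1 B.2.1⟩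
  · have hP2 : finrank F P.1 = 2 := P.2.1.resolve_left hP
    rw [← card_intermediate (bot_le : ⊥ ≤ P.1) (by rw [hP2, finrank_bot])]
    rw [finrank_bot]
    refine Nat.card_congr
      { toFun := fun Q => ⟨Q.1.1, bot_le, ?_, ?_⟩
        invFun := fun B => ⟨⟨B.1, .inl B.2.2.2, fun y hy z hz =>
          P.2.2 y (B.2.2.1 hy) z (B.2.2.1 hz)⟩, ?_⟩
        left_inv := fun _ => rfl
        right_inv := fun _ => rfl }
    · rcases incidenceGraph_adj_iff.1 Q.2 with ⟨h, -, -⟩ | ⟨-, -, h⟩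
      · omega
      · exact h
    · rcases incidenceGraph_adj_iff.1 Q.2 with ⟨h, -, -⟩ | ⟨-, h, -⟩
      · omega
      · exact h
    · exact incidenceGraph_adj_iff.2 (.inr ⟨hP2, B.2.2.2, B.2.2.1⟩)

theorem card_points {D : ℕ} (hc : Nat.card {x : V // m x x = 0} = Nat.card F ^ D) :
    Nat.card {P : Flat m // finrank F P.1 = 1} = ∑ i ∈ Finset.range D, Nat.card F ^ i := by
  have : Finite V := Module.finite_of_finite F
  let f : {x : V // m x x = 0 ∧ x ≠ 0} → {P : Flat m // finrank F P.1 = 1} :=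
    fun x => ⟨point x.1 x.2.2 x.2.1, finrank_span_singleton x.2.2⟩
  have hfib : ∀ P, Nat.card {x // f x = P} = Nat.card F - 1 := by
    rintro ⟨P, hP⟩
    have h := card_mem_and_notMem (bot_le : ⊥ ≤ P.1)
    rw [hP, finrank_bot, pow_one, pow_zero] at h
    rw [← h]
    refine Nat.card_congr
      { toFun := fun x => ⟨x.1.1, ?_, ?_⟩
        invFun := fun x => ⟨⟨x.1, P.2.2 _ x.2.1 _ x.2.1, ?_⟩, ?_⟩
        left_inv := fun _ => rfl
        right_inv := fun _ => rfl }
    · have h1 := congrArg (fun Q => Q.1.1) x.2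
      change F ∙ x.1.1 = P.1 at h1
      rw [← h1]
      exact Submodule.mem_span_singleton_self _
    · simpa using x.1.2.2
    · simpa using x.2.2
    · apply Subtype.ext
      apply Subtype.ext
      apply Submodule.eq_of_le_of_finrank_eq
      · exact (Submodule.span_singleton_le_iff_mem _ _).2 x.2.1
      · have hx0 : x.1 ≠ 0 := by simpa using x.2.2
        exact (finrank_span_singleton hx0).trans hP.symm
  have h := card_eq_mul_of_card_fiber f _ hfib
  have h2 : Nat.card {x : V // m x x = 0 ∧ x ≠ 0} = Nat.card F ^ D - 1 := by
    have h3 := Set.ncard_sdiff (show ({0} : Set V) ⊆ {x : V | m x x = 0} by simp)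
    rw [Set.ncard_singleton] at h3
    rw [← hc]
    exact h3
  rw [h2] at h
  have hq : 1 < Nat.card F := Finite.one_lt_card
  have hg := Nat.geomSum_eq (m := Nat.card F) (by omega) D
  rw [hg, h, Nat.mul_div_cancel _ (by omega)]

/-- Counting the incident pairs in two ways, there are as many lines as points. -/
theorem IsUniform.card_lines (hm : IsUniform m) :
    Nat.card {L : Flat m // finrank F L.1 = 2} = Nat.card {P : Flat m // finrank F P.1 = 1} := by
  let I := {s : Flat m × Flat m //
    finrank F s.1.1 = 1 ∧ finrank F s.2.1 = 2 ∧ (incidenceGraph m).Adj s.1 s.2}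
  have h1 : Nat.card I = Nat.card {P : Flat m // finrank F P.1 = 1} * (Nat.card F + 1) := by
    refine card_eq_mul_of_card_fiber (fun s : I => ⟨s.1.1, s.2.1⟩) _ fun P => ?_
    rw [← hm.ncard_neighborSet P.1, ← Nat.card_coe_set_eq]
    refine Nat.card_congr
      { toFun := fun s => ⟨s.1.1.2, ?_⟩
        invFun := fun L => ⟨⟨(P.1, L.1), P.2, ?_, L.2⟩, rfl⟩
        left_inv := ?_
        right_inv := fun _ => rfl }
    · have h : s.1.1.1 = P.1 := congrArg Subtype.val s.2
      exact h ▸ s.1.2.2.2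
    · rcases incidenceGraph_adj_iff.1 L.2 with ⟨_, h, -⟩ | ⟨h, -, -⟩
      · exact h
      · have := P.2
        omega
    · rintro ⟨⟨⟨P, L⟩, h⟩, rfl⟩
      rfl
  have h2 : Nat.card I = Nat.card {L : Flat m // finrank F L.1 = 2} * (Nat.card F + 1) := by
    refine card_eq_mul_of_card_fiber (fun s : I => ⟨s.1.2, s.2.2.1⟩) _ fun L => ?_
    rw [← hm.ncard_neighborSet L.1, ← Nat.card_coe_set_eq]
    refine Nat.card_congr
      { toFun := fun s => ⟨s.1.1.1, ?_⟩
        invFun := fun P => ⟨⟨(P.1, L.1), ?_, L.2, P.2.symm⟩, rfl⟩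
        left_inv := ?_
        right_inv := fun _ => rfl }
    · have h : s.1.1.2 = L.1 := congrArg Subtype.val s.2
      exact h ▸ s.1.2.2.2.symm
    · rcases incidenceGraph_adj_iff.1 P.2 with ⟨h, -, -⟩ | ⟨-, h, -⟩
      · have := L.2
        omega
      · exact h
    · rintro ⟨⟨⟨P, L⟩, h⟩, rfl⟩
      rfl
  exact Nat.eq_of_mul_eq_mul_right (Nat.succ_pos _) (h2.symm.trans h1)

theorem IsUniform.card_flat (hm : IsUniform m) {D : ℕ}
    (hc : Nat.card {x : V // m x x = 0} = Nat.card F ^ D) :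
    Nat.card (Flat m) = 2 * ∑ i ∈ Finset.range D, Nat.card F ^ i := by
  classical
  have e : Flat m ≃ {P : Flat m // finrank F P.1 = 1} ⊕ {P : Flat m // finrank F P.1 = 2} :=
    (Equiv.sumCompl fun P : Flat m => finrank F P.1 = 1).symm.trans
      (Equiv.sumCongr (Equiv.refl _) (Equiv.subtypeEquivRight fun P => by
        have := P.2.1
        omega))
  rw [Nat.card_congr e, Nat.card_sum, hm.card_lines, card_points hc, two_mul]

theorem IsUniform.isMooreBipartite (hm : IsUniform m) {D : ℕ}
    (hc : Nat.card {x : V // m x x = 0} = Nat.card F ^ D)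
    (hd : (incidenceGraph m).ediam = D) :
    IsMooreBipartite (incidenceGraph m) (Nat.card F + 1) D where
  finite := inferInstance
  bipartite := ⟨(incidenceGraph m).recolorOfEquiv finTwoEquiv.symm (typeColoring m)⟩
  regular := hm.ncard_neighborSet
  diam := hd
  order := hm.card_flat hc

theorem IsUniform.exists_adj (hm : IsUniform m) (P : Flat m) :
    ∃ Q, (incidenceGraph m).Adj P Q := by
  have h := hm.ncard_neighborSet P
  exact Set.nonempty_of_ncard_ne_zero (s := (incidenceGraph m).neighborSet P) (by omega)

/-- Since every vertex has a neighbour of the other type, a bound `n` on the distance from points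
to lines bounds the diameter by `n + 1`. -/
theorem IsUniform.ediam_le (hm : IsUniform m) {n : ℕ}
    (h : ∀ (x : V) (hx : x ≠ 0) (hxx : m x x = 0) (L : Flat m), finrank F L.1 = 2 →
      (incidenceGraph m).edist (point x hx hxx) L ≤ n) :
    (incidenceGraph m).ediam ≤ ((n + 1 : ℕ) : ℕ∞) := by
  have h' : ∀ P L : Flat m, finrank F P.1 = 1 → finrank F L.1 = 2 →
      (incidenceGraph m).edist P L ≤ n := by
    intro P L hP hL
    obtain ⟨x, hx, hxx, rfl⟩ := exists_eq_point P hP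
    exact h x hx hxx L hL
  refine SimpleGraph.ediam_le_of_edist_le fun P Q => ?_
  obtain ⟨R, hR⟩ := hm.exists_adj P
  have hR1 : (incidenceGraph m).edist P R ≤ 1 := (SimpleGraph.edist_eq_one_iff_adj.2 hR).le
  have key : (incidenceGraph m).edist P Q ≤ n ∨ (incidenceGraph m).edist R Q ≤ n := by
    rcases P.2.1 with hP | hP <;> rcases Q.2.1 with hQ | hQ
    · right
      rcases incidenceGraph_adj_iff.1 hR with ⟨-, h2, -⟩ | ⟨h2, -, -⟩
      · rw [SimpleGraph.edist_comm]; exact h' Q R hQ h2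
      · omega
    · exact .inl (h' P Q hP hQ)
    · left; rw [SimpleGraph.edist_comm]; exact h' Q P hQ hP
    · right
      rcases incidenceGraph_adj_iff.1 hR with ⟨h2, -, -⟩ | ⟨-, h2, -⟩
      · omega
      · exact h' R Q h2 hQ
  rcases key with h | h
  · exact h.trans (by exact_mod_cast Nat.le_succ n)
  · calc _ ≤ _ := SimpleGraph.edist_triangle (v := R)
      _ ≤ 1 + (n : ℕ∞) := add_le_add hR1 h
      _ = ((n + 1 : ℕ) : ℕ∞) := by push_cast; ring

end Geometry

/-! ### Transport along isomorphisms -/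

theorem edist_map_le {V V' : Type*} {G : SimpleGraph V} {G' : SimpleGraph V'} (f : G →g G')
    (u v : V) : G'.edist (f u) (f v) ≤ G.edist u v := by
  refine le_iInf fun p => ?_
  have h := SimpleGraph.edist_le (p.map f)
  rwa [SimpleGraph.Walk.length_map] at h

theorem IsMooreBipartite.of_iso {V V' : Type*} {G : SimpleGraph V} {G' : SimpleGraph V'}
    {Δ D : ℕ} (e : G ≃g G') (h : IsMooreBipartite G Δ D) : IsMooreBipartite G' Δ D where
  finite := have := h.finite; Finite.of_equiv V e.toEquiv
  bipartite := h.bipartite.of_hom e.symm.toHom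
  regular v := by
    rw [← h.regular (e.symm v), ← Nat.card_coe_set_eq, ← Nat.card_coe_set_eq]
    have := e.mapNeighborSet (e.symm v)
    rw [RelIso.apply_symm_apply] at this
    exact (Nat.card_congr this).symm
  diam := by
    rw [← h.diam]
    apply le_antisymm
    · refine SimpleGraph.ediam_le_of_edist_le fun u v => ?_
      have h1 := edist_map_le e.toHom (e.symm u) (e.symm v)
      simp only [RelIso.coe_toRelEmbedding, RelEmbedding.coe_toRelHom,
        RelIso.apply_symm_apply] at h1
      exact h1.trans SimpleGraph.edist_le_ediam
    · refine SimpleGraph.ediam_le_of_edist_le fun u v => ?_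
      have h1 := edist_map_le e.symm.toHom (e u) (e v)
      simp only [RelIso.coe_toRelEmbedding, RelEmbedding.coe_toRelHom,
        RelIso.symm_apply_apply] at h1
      exact h1.trans SimpleGraph.edist_le_ediam
  order := by rw [← h.order, Nat.card_congr e.toEquiv]

theorem IsMooreBipartite.exists_fin {V : Type*} {G : SimpleGraph V} {Δ D : ℕ}
    (h : IsMooreBipartite G Δ D) :
    ∃ (n : ℕ) (B : SimpleGraph (Fin n)), IsMooreBipartite B Δ D := by
  have := h.finite
  exact ⟨Nat.card V, _, h.of_iso (SimpleGraph.Iso.map (Finite.equivFin V) G)⟩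

/-! ### Lower bounds for the distance of two points -/

section LowerBounds

open Module

variable {F V W : Type*} [Field F] [AddCommGroup V] [Module F V] [AddCommGroup W] [Module F W]
  {m : V →ₗ[F] V →ₗ[F] W}

theorem orthogonal_of_point_eq {x y z : V} {hx : x ≠ 0} {hxx : m x x = 0} {hy : y ≠ 0}
    {hyy : m y y = 0} (h : (point x hx hxx : Flat m) = point y hy hyy) (hz : m z x = 0) :
    m z y = 0 := by
  have h1 : F ∙ x = F ∙ y := congrArg Subtype.val h
  have h2 : y ∈ F ∙ x := h1 ▸ Submodule.mem_span_singleton_self y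
  obtain ⟨c, rfl⟩ := Submodule.mem_span_singleton.1 h2
  simp [hz]

variable [Module.Finite F V]

/-- A lower bound for the distance of two points, which only has to be checked on walks of even
length. -/
theorem le_edist_point_point {x y : V} {hx : x ≠ 0} {hxx : m x x = 0} {hy : y ≠ 0}
    {hyy : m y y = 0} {n : ℕ}
    (h : ∀ p : (incidenceGraph m).Walk (point x hx hxx) (point y hy hyy), Even p.length →
      n ≤ p.length) :
    (n : ℕ∞) ≤ (incidenceGraph m).edist (point x hx hxx) (point y hy hyy) :=
  le_iInf fun p => by exact_mod_cast h p (even_length_of_walk p)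

/-- Points that are not orthogonal have no line in common. -/
theorem four_le_edist {x y : V} {hx : x ≠ 0} {hxx : m x x = 0} {hy : y ≠ 0}
    {hyy : m y y = 0} (h : m x y ≠ 0) :
    ((4 : ℕ) : ℕ∞) ≤ (incidenceGraph m).edist (point x hx hxx) (point y hy hyy) := by
  refine le_edist_point_point fun p hp => ?_
  by_contra hlt
  have h02 : p.length = 0 ∨ p.length = 0 + 2 := by
    obtain ⟨k, hk⟩ := hp; omega
  rcases h02 with h0 | h2
  · exact h (orthogonal_of_point_eq (SimpleGraph.Walk.eq_of_length_eq_zero h0) hxx)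
  · obtain ⟨z, hz, hzz, p', hxz, h0⟩ := exists_orthogonal_of_walk p h2
    exact h (orthogonal_of_point_eq (SimpleGraph.Walk.eq_of_length_eq_zero h0) hxz)

/-- Points to which no third point is simultaneously orthogonal are at distance at least `6`; the
case `z = x` of the hypothesis excludes the distances `0` and `2`. -/
theorem six_le_edist {x y : V} {hx : x ≠ 0} {hxx : m x x = 0} {hy : y ≠ 0}
    {hyy : m y y = 0} (h : ∀ z, z ≠ 0 → m x z = 0 → m z y ≠ 0) :
    ((6 : ℕ) : ℕ∞) ≤ (incidenceGraph m).edist (point x hx hxx) (point y hy hyy) := by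
  refine le_edist_point_point fun p hp => ?_
  by_contra hlt
  have h4 : 4 ≤ p.length := by
    have h1 := (four_le_edist (hx := hx) (hxx := hxx) (hy := hy) (hyy := hyy)
      (h x hx hxx)).trans (SimpleGraph.edist_le p)
    exact_mod_cast h1
  have h4' : p.length = 2 + 2 := by
    obtain ⟨k, hk⟩ := hp; omega
  obtain ⟨z, hz, hzz, p', hxz, h2⟩ := exists_orthogonal_of_walk p h4'
  obtain ⟨w, hw, hww, p'', hzw, h0⟩ := exists_orthogonal_of_walk p' (n := 0) h2
  exact h z hz hxz (orthogonal_of_point_eq (SimpleGraph.Walk.eq_of_length_eq_zero h0) hzw)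

end LowerBounds

/-! ### Generalized triangles: projective planes -/

section Plane

open Module

variable (F : Type*) [Field F]

/-- The zero form on `F ^ 3`: every subspace is totally isotropic, so its geometry is the projective
plane over `F`. -/
abbrev planeForm : (Fin 3 → F) →ₗ[F] (Fin 3 → F) →ₗ[F] F := 0

theorem isUniform_planeForm : IsUniform (planeForm F) where
  finrank_ker x _ _ := by
    change finrank F (LinearMap.ker (0 : (Fin 3 → F) →ₗ[F] F)) = 3
    rw [LinearMap.ker_zero, finrank_top, finrank_fin_fun]
  isotropic _ _ _ _ _ := rfl
  symm _ _ _ _ _ := rfl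

theorem ediam_planeForm : (incidenceGraph (planeForm F)).ediam = ((3 : ℕ) : ℕ∞) := by
  have hm := isUniform_planeForm F
  have hPL : ∀ P L : Flat (planeForm F), finrank F P.1 = 1 → finrank F L.1 = 2 →
      (incidenceGraph (planeForm F)).edist P L ≤ ((3 : ℕ) : ℕ∞) := by
    intro P L hP hL
    obtain ⟨x, hx, hxx, rfl⟩ := exists_eq_point P hP
    obtain ⟨y, hyL, hy, -⟩ := exists_mem_line_map_eq_zero 0 L.1 hL
    exact edist_le_of_mem (hyy := rfl) (hy := hy) (n := 2) hL hyL
      (hm.edist_point_point_le_two rfl)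
  apply le_antisymm
  · refine SimpleGraph.ediam_le_of_edist_le fun P Q => ?_
    rcases P.2.1 with hP | hP <;> rcases Q.2.1 with hQ | hQ
    · obtain ⟨x, hx, hxx, rfl⟩ := exists_eq_point P hP
      obtain ⟨y, hy, hyy, rfl⟩ := exists_eq_point Q hQ
      exact (hm.edist_point_point_le_two rfl).trans (by norm_num)
    · exact hPL P Q hP hQ
    · rw [SimpleGraph.edist_comm]; exact hPL Q P hQ hP
    · -- two lines of a projective plane meet
      have h1 := Submodule.finrank_sup_add_finrank_inf_eq P.1 Q.1
      have h2 := Submodule.finrank_le (P.1 ⊔ Q.1)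
      rw [finrank_fin_fun] at h2
      have h3 : P.1 ⊓ Q.1 ≠ ⊥ := by
        intro h
        rw [h, finrank_bot] at h1
        omega
      obtain ⟨x, hx, hx0⟩ := Submodule.exists_mem_ne_zero_of_ne_bot h3
      have h4 : (incidenceGraph (planeForm F)).Adj (point x hx0 rfl) P :=
        adj_point_iff.2 ⟨hP, hx.1⟩
      have h5 : (incidenceGraph (planeForm F)).Adj (point x hx0 rfl) Q :=
        adj_point_iff.2 ⟨hQ, hx.2⟩
      have h6 := SimpleGraph.edist_le (.cons h4.symm (.cons h5 .nil))
      exact h6.trans (by norm_num)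
  · -- a point which is not on a given line
    let φ : (Fin 3 → F) →ₗ[F] F := LinearMap.proj 0
    have hφ : φ ≠ 0 := fun h => by
      have := LinearMap.congr_fun h (fun _ => 1)
      simp [φ] at this
    have hk := Module.Dual.finrank_ker_add_one_of_ne_zero hφ
    rw [finrank_fin_fun] at hk
    let L : Flat (planeForm F) :=
      ⟨LinearMap.ker φ, .inr (by omega), fun _ _ _ _ => rfl⟩
    have hx : (fun _ => 1 : Fin 3 → F) ≠ 0 := fun h => one_ne_zero (congrFun h 0)
    have hlt : 2 < (incidenceGraph (planeForm F)).edist (point _ hx rfl) L := by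
      rw [SimpleGraph.two_lt_edist_iff]
      have hxL : ¬ (incidenceGraph (planeForm F)).Adj (point _ hx rfl) L := fun h => by
        have := (adj_point_iff.1 h).2
        simp [L, φ] at this
      refine ⟨fun h => ?_, hxL, Set.eq_empty_iff_forall_notMem.2 fun R hR => ?_⟩
      · have h1 : finrank F (point _ hx rfl : Flat (planeForm F)).1 = 1 :=
          finrank_span_singleton hx
        rw [h] at h1
        have h2 : finrank F L.1 = 2 := by change finrank F (LinearMap.ker φ) = 2; omega
        omega
      · have h1 := (adj_point_iff.1 hR.1).1
        have h2 : finrank F L.1 = 2 := by change finrank F (LinearMap.ker φ) = 2; omega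
        rcases incidenceGraph_adj_iff.1 hR.2 with ⟨h3, -, -⟩ | ⟨-, h3, -⟩ <;> omega
    exact (Order.add_one_le_of_lt hlt).trans SimpleGraph.edist_le_ediam

theorem isMooreBipartite_planeForm [Finite F] :
    IsMooreBipartite (incidenceGraph (planeForm F)) (Nat.card F + 1) 3 :=
  (isUniform_planeForm F).isMooreBipartite (by simp [Nat.card_fun]) (ediam_planeForm F)

end Plane

/-! ### Generalized quadrangles: the symplectic geometry of `F ^ 4` -/

section Symplectic

open Module

variable (F : Type*) [Field F]

/-- The standard symplectic form on `F ^ 4`. -/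
def symplecticForm : (Fin 4 → F) →ₗ[F] (Fin 4 → F) →ₗ[F] F :=
  LinearMap.mk₂ F (fun x y => x 0 * y 1 - x 1 * y 0 + (x 2 * y 3 - x 3 * y 2))
    (fun _ _ _ => by simp; ring) (fun _ _ _ => by simp; ring)
    (fun _ _ _ => by simp; ring) (fun _ _ _ => by simp; ring)

variable {F} in
theorem symplecticForm_apply (x y : Fin 4 → F) :
    symplecticForm F x y = x 0 * y 1 - x 1 * y 0 + (x 2 * y 3 - x 3 * y 2) := rfl

theorem isUniform_symplecticForm : IsUniform (symplecticForm F) where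
  finrank_ker x hx _ := by
    have hne : symplecticForm F x ≠ 0 := by
      intro h
      apply hx
      have h0 := LinearMap.congr_fun h (Pi.single 0 1)
      have h1 := LinearMap.congr_fun h (Pi.single 1 1)
      have h2 := LinearMap.congr_fun h (Pi.single 2 1)
      have h3 := LinearMap.congr_fun h (Pi.single 3 1)
      simp [symplecticForm_apply] at h0 h1 h2 h3
      ext i
      fin_cases i <;> simp [*]
    have hk := Module.Dual.finrank_ker_add_one_of_ne_zero hne
    rw [finrank_fin_fun] at hk
    omega
  isotropic x y _ _ _ := by rw [symplecticForm_apply]; ring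
  symm x y _ _ h := by
    rw [symplecticForm_apply] at h ⊢
    linear_combination -h

variable [Finite F]

theorem ediam_symplecticForm : (incidenceGraph (symplecticForm F)).ediam = ((4 : ℕ) : ℕ∞) := by
  have hm := isUniform_symplecticForm F
  have hi : ∀ x, symplecticForm F x x = 0 := fun x => by rw [symplecticForm_apply]; ring
  apply le_antisymm
  · refine hm.ediam_le (n := 3) fun x hx hxx L hL => ?_
    obtain ⟨y, hyL, hy, hxy⟩ := exists_mem_line_map_eq_zero (symplecticForm F x) L.1 hL
    exact edist_le_of_mem (hyy := hi y) (hy := hy) (n := 2) hL hyL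
      (hm.edist_point_point_le_two hxy)
  · have hx : (Pi.single 0 1 : Fin 4 → F) ≠ 0 := by simp
    have hy : (Pi.single 1 1 : Fin 4 → F) ≠ 0 := by simp
    refine le_trans (four_le_edist (hx := hx) (hxx := hi _) (hy := hy) (hyy := hi _) ?_)
      SimpleGraph.edist_le_ediam
    simp [symplecticForm_apply]

theorem isMooreBipartite_symplecticForm :
    IsMooreBipartite (incidenceGraph (symplecticForm F)) (Nat.card F + 1) 4 := by
  refine (isUniform_symplecticForm F).isMooreBipartite ?_ (ediam_symplecticForm F)
  have hi : ∀ x, symplecticForm F x x = 0 := fun x => by rw [symplecticForm_apply]; ring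
  simp [hi, Nat.card_fun]

end Symplectic

/-! ### Generalized hexagons: nilpotent split octonions -/

section Octonion

open Module

variable {F : Type*} [Field F]

theorem octonion_ext {F : Type*} {x y : Fin 8 → F}
    (h0 : x 0 = y 0) (h1 : x 1 = y 1) (h2 : x 2 = y 2) (h3 : x 3 = y 3)
    (h4 : x 4 = y 4) (h5 : x 5 = y 5) (h6 : x 6 = y 6) (h7 : x 7 = y 7) :
    x = y := by
  funext i
  fin_cases i <;> assumption

theorem octonion_eq_zero_iff {F : Type*} [Zero F] {x : Fin 8 → F} : x = 0 ↔ x 0 = 0 ∧ x 1 = 0 ∧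
    x 2 = 0 ∧ x 3 = 0 ∧ x 4 = 0 ∧ x 5 = 0 ∧ x 6 = 0 ∧ x 7 = 0 :=
  ⟨by rintro rfl; simp, fun ⟨h0, h1, h2, h3, h4, h5, h6, h7⟩ =>
    octonion_ext h0 h1 h2 h3 h4 h5 h6 h7⟩

/-- The product of the split octonion algebra in Zorn's vector matrices: the octonion `x` stands
for the matrix with diagonal entries `x 0` and `x 7` and off-diagonal entries the vectors
`(x 1, x 2, x 3)` and `(x 4, x 5, x 6)`. -/
def zornMul (x y : Fin 8 → F) : Fin 8 → F
  | 0 => x 0 * y 0 + x 1 * y 4 + x 2 * y 5 + x 3 * y 6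
  | 1 => x 0 * y 1 + x 1 * y 7 - (x 5 * y 6 - x 6 * y 5)
  | 2 => x 0 * y 2 + x 2 * y 7 - (x 6 * y 4 - x 4 * y 6)
  | 3 => x 0 * y 3 + x 3 * y 7 - (x 4 * y 5 - x 5 * y 4)
  | 4 => x 4 * y 0 + x 7 * y 4 + (x 2 * y 3 - x 3 * y 2)
  | 5 => x 5 * y 0 + x 7 * y 5 + (x 3 * y 1 - x 1 * y 3)
  | 6 => x 6 * y 0 + x 7 * y 6 + (x 1 * y 2 - x 2 * y 1)
  | 7 => x 4 * y 1 + x 5 * y 2 + x 6 * y 3 + x 7 * y 7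

variable (F) in
/-- The product of the split octonions as a bilinear map. -/
def octMul : (Fin 8 → F) →ₗ[F] (Fin 8 → F) →ₗ[F] (Fin 8 → F) :=
  LinearMap.mk₂ F zornMul
    (fun _ _ _ => by apply octonion_ext <;> simp only [zornMul, Pi.add_apply] <;> ring)
    (fun _ _ _ => by
      apply octonion_ext <;> simp only [zornMul, Pi.smul_apply, smul_eq_mul] <;> ring)
    (fun _ _ _ => by apply octonion_ext <;> simp only [zornMul, Pi.add_apply] <;> ring)
    (fun _ _ _ => by
      apply octonion_ext <;> simp only [zornMul, Pi.smul_apply, smul_eq_mul] <;> ring)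

theorem octMul_apply (x y : Fin 8 → F) : octMul F x y = zornMul x y := rfl

variable (F) in
/-- The trace of a split octonion. -/
def octTrace : (Fin 8 → F) →ₗ[F] F :=
  (LinearMap.proj 0 : (Fin 8 → F) →ₗ[F] F) + LinearMap.proj 7

theorem octTrace_apply (x : Fin 8 → F) : octTrace F x = x 0 + x 7 := rfl

/-- The norm of a split octonion. -/
def octNorm (x : Fin 8 → F) : F := x 0 * x 7 - (x 1 * x 4 + x 2 * x 5 + x 3 * x 6)

/-- The polar form of the norm of the split octonions. -/
def octPolar (x y : Fin 8 → F) : F :=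
  x 0 * y 7 + x 7 * y 0 -
    (x 1 * y 4 + x 4 * y 1 + (x 2 * y 5 + x 5 * y 2) + (x 3 * y 6 + x 6 * y 3))

/-- The unit of the split octonions. -/
def octOne : Fin 8 → F
  | 0 => 1
  | 1 => 0
  | 2 => 0
  | 3 => 0
  | 4 => 0
  | 5 => 0
  | 6 => 0
  | 7 => 1

/-- The quadratic equation of an octonion. -/
theorem octMul_self (x : Fin 8 → F) :
    octMul F x x = octTrace F x • x - octNorm x • octOne := by
  apply octonion_ext <;> simp only [octMul_apply, zornMul, octTrace_apply, octNorm, octOne,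
    Pi.sub_apply, Pi.smul_apply, smul_eq_mul] <;> ring

/-- Left alternativity, combined with the quadratic equation and linearized. -/
theorem octMul_octMul_add (x w y : Fin 8 → F) :
    octMul F x (octMul F w y) + octMul F w (octMul F x y) =
      octTrace F x • octMul F w y + octTrace F w • octMul F x y - octPolar x w • y := by
  apply octonion_ext <;> simp only [octMul_apply, zornMul, octTrace_apply, octPolar, Pi.add_apply,
    Pi.sub_apply, Pi.smul_apply, smul_eq_mul] <;> ring

/-- Left alternativity, combined with the quadratic equation. -/
theorem octMul_octMul_self_left (x y : Fin 8 → F) :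
    octMul F x (octMul F x y) = octTrace F x • octMul F x y - octNorm x • y := by
  apply octonion_ext <;> simp only [octMul_apply, zornMul, octTrace_apply, octNorm,
    Pi.sub_apply, Pi.smul_apply, smul_eq_mul] <;> ring

/-- Right alternativity, combined with the quadratic equation. -/
theorem octMul_octMul_self_right (x y : Fin 8 → F) :
    octMul F (octMul F x y) y = octTrace F y • octMul F x y - octNorm y • x := by
  apply octonion_ext <;> simp only [octMul_apply, zornMul, octTrace_apply, octNorm,
    Pi.sub_apply, Pi.smul_apply, smul_eq_mul] <;> ring

/-- The linearized quadratic equation. -/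
theorem octMul_add_octMul (x y : Fin 8 → F) :
    octMul F x y + octMul F y x =
      octTrace F x • y + octTrace F y • x - octPolar x y • octOne := by
  apply octonion_ext <;> simp only [octMul_apply, zornMul, octTrace_apply, octPolar, octOne,
    Pi.add_apply, Pi.sub_apply, Pi.smul_apply, smul_eq_mul] <;> ring

theorem octTrace_octMul (x y : Fin 8 → F) :
    octTrace F (octMul F x y) = octTrace F x * octTrace F y - octPolar x y := by
  simp only [octMul_apply, zornMul, octTrace_apply, octPolar]
  ring

/-- The polar form of the norm is nondegenerate. -/
theorem exists_octPolar_ne_zero {x : Fin 8 → F} (hx : x ≠ 0) : ∃ w, octPolar x w ≠ 0 := by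
  by_contra! h
  apply hx
  have h0 := h (Pi.single 0 1)
  have h1 := h (Pi.single 1 1)
  have h2 := h (Pi.single 2 1)
  have h3 := h (Pi.single 3 1)
  have h4 := h (Pi.single 4 1)
  have h5 := h (Pi.single 5 1)
  have h6 := h (Pi.single 6 1)
  have h7 := h (Pi.single 7 1)
  simp [octPolar] at h0 h1 h2 h3 h4 h5 h6 h7
  ext i
  fin_cases i <;> simp [*]

variable (F) in
/-- The bilinear map `(x, y) ↦ (x y, y x)` on the split octonions. For nilpotent `x ≠ 0`, including
the product `y x` forces `y` to have trace zero (`octForm_eq_zero_iff_of_trace`), which cuts the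
annihilator of `x` down from dimension `4` to dimension `3`. -/
def octForm : (Fin 8 → F) →ₗ[F] (Fin 8 → F) →ₗ[F] (Fin 8 → F) × (Fin 8 → F) :=
  LinearMap.mk₂ F (fun x y => (octMul F x y, octMul F y x))
    (fun _ _ _ => by simp) (fun _ _ _ => by simp) (fun _ _ _ => by simp) (fun _ _ _ => by simp)

theorem octForm_eq_zero_iff {x y : Fin 8 → F} :
    octForm F x y = 0 ↔ octMul F x y = 0 ∧ octMul F y x = 0 := Prod.mk_eq_zero

/-- The isotropic vectors of `octForm` are the octonions of square zero, which are those of trace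
and norm zero. -/
theorem octForm_self_eq_zero_iff {x : Fin 8 → F} :
    octForm F x x = 0 ↔ octTrace F x = 0 ∧ octNorm x = 0 := by
  rw [octForm_eq_zero_iff, and_self_iff]
  constructor
  · intro h
    have e : ∀ i, octMul F x x i = 0 := fun i => by rw [h]; rfl
    have e0 := e 0
    have e1 := e 1
    have e2 := e 2
    have e3 := e 3
    have e7 := e 7
    simp only [octMul_apply, zornMul] at e0 e1 e2 e3 e7
    have ht : octTrace F x = 0 := by
      rw [octTrace_apply]
      by_contra ht
      have f1 : x 1 = 0 := (mul_eq_zero.1 (by linear_combination e1 :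
        (x 0 + x 7) * x 1 = 0)).resolve_left ht
      have f2 : x 2 = 0 := (mul_eq_zero.1 (by linear_combination e2 :
        (x 0 + x 7) * x 2 = 0)).resolve_left ht
      have f3 : x 3 = 0 := (mul_eq_zero.1 (by linear_combination e3 :
        (x 0 + x 7) * x 3 = 0)).resolve_left ht
      simp [f1, f2, f3] at e0 e7
      exact ht (by rw [e0, e7, add_zero])
    refine ⟨ht, ?_⟩
    rw [octTrace_apply] at ht
    rw [octNorm]
    linear_combination x 0 * ht - e0
  · rintro ⟨h1, h2⟩
    rw [octMul_self, h1, h2]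
    simp

/-- For octonions of trace zero, `y x` is the conjugate of `x y`. -/
theorem octForm_eq_zero_iff_of_trace {x y : Fin 8 → F} (hx : x ≠ 0) (htx : octTrace F x = 0) :
    octForm F x y = 0 ↔ octMul F x y = 0 ∧ octTrace F y = 0 := by
  rw [octForm_eq_zero_iff]
  have h1 := octMul_add_octMul x y
  have h2 := octTrace_octMul x y
  rw [htx] at h1 h2
  constructor
  · rintro ⟨h, h'⟩
    rw [h, h'] at h1
    rw [h] at h2
    simp only [map_zero, zero_mul, zero_sub] at h2
    have h3 : octPolar x y = 0 := by linear_combination h2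
    simp only [h3, zero_smul, add_zero, zero_add, sub_zero] at h1
    exact ⟨h, (smul_eq_zero.1 h1.symm).resolve_right hx⟩
  · rintro ⟨h, h'⟩
    refine ⟨h, ?_⟩
    rw [h] at h2 h1
    simp only [map_zero, zero_mul, zero_sub] at h2
    have h3 : octPolar x y = 0 := by linear_combination h2
    simpa [h3, h'] using h1

/-- The left annihilator of a nilpotent octonion `x ≠ 0` is the image of the multiplication by
`x`: if `x y = 0` then `x (w y) = - B(x, w) y`, and `w` can be taken with `B(x, w) ≠ 0`. -/
theorem finrank_ker_octMul {x : Fin 8 → F} (hx : x ≠ 0) (htx : octTrace F x = 0)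
    (hnx : octNorm x = 0) : finrank F (LinearMap.ker (octMul F x)) = 4 := by
  have h : LinearMap.range (octMul F x) = LinearMap.ker (octMul F x) := by
    apply le_antisymm
    · rintro _ ⟨y, rfl⟩
      rw [LinearMap.mem_ker, octMul_octMul_self_left, htx, hnx]
      simp
    · intro y hy
      rw [LinearMap.mem_ker] at hy
      obtain ⟨w, hw⟩ := exists_octPolar_ne_zero hx
      have h1 := octMul_octMul_add x w y
      rw [hy, htx] at h1
      simp only [map_zero, add_zero, zero_smul, smul_zero, zero_sub] at h1
      refine ⟨-(octPolar x w)⁻¹ • octMul F w y, ?_⟩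
      rw [map_smul, h1, smul_neg, neg_smul, neg_neg, smul_smul, inv_mul_cancel₀ hw, one_smul]
  have h1 := LinearMap.finrank_range_add_finrank_ker (octMul F x)
  rw [h, finrank_fin_fun] at h1
  omega

theorem isUniform_octForm : IsUniform (octForm F) where
  finrank_ker x hx hxx := by
    obtain ⟨ht, hn⟩ := octForm_self_eq_zero_iff.1 hxx
    have h4 := finrank_ker_octMul hx ht hn
    have hker : LinearMap.ker (octForm F x) = (LinearMap.ker
        ((octTrace F).domRestrict (LinearMap.ker (octMul F x)))).map
        (LinearMap.ker (octMul F x)).subtype := by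
      ext y
      rw [LinearMap.mem_ker, octForm_eq_zero_iff_of_trace hx ht]
      simp [and_comm]
    have hne : (octTrace F).domRestrict (LinearMap.ker (octMul F x)) ≠ 0 := by
      obtain ⟨w, hw⟩ := exists_octPolar_ne_zero hx
      intro h
      have hmem : octMul F x w ∈ LinearMap.ker (octMul F x) := by
        rw [LinearMap.mem_ker, octMul_octMul_self_left, ht, hn]
        simp
      have h1 := LinearMap.congr_fun h ⟨octMul F x w, hmem⟩
      simp only [LinearMap.domRestrict_apply, LinearMap.zero_apply] at h1
      rw [octTrace_octMul, ht] at h1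
      apply hw
      linear_combination -h1
    have h3 := Module.Dual.finrank_ker_add_one_of_ne_zero hne
    rw [hker, Submodule.finrank_map_subtype_eq]
    omega
  isotropic x y hx hxx h := by
    obtain ⟨ht, hn⟩ := octForm_self_eq_zero_iff.1 hxx
    obtain ⟨h1, h2⟩ := (octForm_eq_zero_iff_of_trace hx ht).1 h
    have h3 := octMul_octMul_self_right x y
    rw [h1, h2] at h3
    simp only [map_zero, LinearMap.zero_apply, smul_zero, zero_sub, zero_eq_neg] at h3
    exact octForm_self_eq_zero_iff.2 ⟨h2, (smul_eq_zero.1 h3).resolve_right hx⟩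
  symm x y _ _ h := by
    rw [octForm_eq_zero_iff] at h ⊢
    exact h.symm

variable (F) [Finite F]

/-- If `x y` has trace zero for isotropic `x`, `y`, then `x y`, unless it is zero, is collinear with
both. On a given line some `y` has this property, so that every point is at distance at most `5`
from the line. -/
theorem ediam_octForm : (incidenceGraph (octForm F)).ediam = ((6 : ℕ) : ℕ∞) := by
  have hm := isUniform_octForm (F := F)
  apply le_antisymm
  · refine hm.ediam_le (n := 5) fun x hx hxx L hL => ?_
    obtain ⟨htx, hnx⟩ := octForm_self_eq_zero_iff.1 hxx
    obtain ⟨y, hyL, hy, hxy⟩ :=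
      exists_mem_line_map_eq_zero (octTrace F ∘ₗ octMul F x) L.1 hL
    have hyy := L.2.2 y hyL y hyL
    obtain ⟨hty, hny⟩ := octForm_self_eq_zero_iff.1 hyy
    refine edist_le_of_mem (hyy := hyy) (hy := hy) (n := 4) hL hyL ?_
    by_cases hz : octMul F x y = 0
    · exact (hm.edist_point_point_le_two
        ((octForm_eq_zero_iff_of_trace hx htx).2 ⟨hz, hty⟩)).trans (by norm_num)
    · have htz : octTrace F (octMul F x y) = 0 := hxy
      have hxz : octForm F x (octMul F x y) = 0 := by
        rw [octForm_eq_zero_iff_of_trace hx htx, octMul_octMul_self_left, htx, hnx]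
        exact ⟨by simp, htz⟩
      have hzy : octForm F (octMul F x y) y = 0 := by
        rw [octForm_eq_zero_iff_of_trace hz htz, octMul_octMul_self_right, hty, hny]
        exact ⟨by simp, rfl⟩
      have hzz := hm.isotropic x _ hx hxx hxz
      calc _ ≤ _ := SimpleGraph.edist_triangle (v := point _ hz hzz)
        _ ≤ 2 + 2 := add_le_add (hm.edist_point_point_le_two hxz)
            (hm.edist_point_point_le_two hzy)
        _ = ((4 : ℕ) : ℕ∞) := by norm_num
  · have hx : (Pi.single 1 1 : Fin 8 → F) ≠ 0 := by simp
    have hy : (Pi.single 4 1 : Fin 8 → F) ≠ 0 := by simp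
    have hxx : octForm F (Pi.single 1 1) (Pi.single 1 1) = 0 := by
      simp [octForm_self_eq_zero_iff, octTrace_apply, octNorm]
    have hyy : octForm F (Pi.single 4 1) (Pi.single 4 1) = 0 := by
      simp [octForm_self_eq_zero_iff, octTrace_apply, octNorm]
    refine le_trans (six_le_edist (hx := hx) (hxx := hxx) (hy := hy) (hyy := hyy) ?_)
      SimpleGraph.edist_le_ediam
    -- no nonzero octonion is annihilated by both of these, on either side
    intro z hz hxz hzy
    apply hz
    have h1 := (octForm_eq_zero_iff.1 hxz)
    have h2 := (octForm_eq_zero_iff.1 hzy)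
    simp [octMul_apply, octonion_eq_zero_iff, zornMul] at h1 h2
    ext i
    fin_cases i <;> simp [*]

/-- For every value of the coordinates `1, 2, 3` there are exactly `q ^ 3` isotropic octonions. -/
theorem card_isotropic_octForm :
    Nat.card {x : Fin 8 → F // octForm F x x = 0} = Nat.card F ^ 6 := by
  let f : {x : Fin 8 → F // octForm F x x = 0} → (Fin 3 → F) :=
    fun x => ![x.1 1, x.1 2, x.1 3]
  have hfib : ∀ u, Nat.card {x // f x = u} = Nat.card F ^ 3 := by
    intro u
    -- a fibre is the quadric `a ^ 2 + u ⬝ v = 0` in the coordinates `a` and `v = (4, 5, 6)`: the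
    -- equation gives `a = 0` if `u = 0`, and otherwise determines one coordinate of `v`
    have key : ∀ x : {x // f x = u}, x.1.1 1 = u 0 ∧ x.1.1 2 = u 1 ∧ x.1.1 3 = u 2 ∧
        x.1.1 7 = - x.1.1 0 ∧
        x.1.1 0 * x.1.1 0 + u 0 * x.1.1 4 + u 1 * x.1.1 5 + u 2 * x.1.1 6 = 0 := by
      rintro ⟨⟨x, hx⟩, rfl⟩
      obtain ⟨h1, h2⟩ := octForm_self_eq_zero_iff.1 hx
      rw [octTrace_apply] at h1
      rw [octNorm] at h2
      refine ⟨rfl, rfl, rfl, by linear_combination h1, ?_⟩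
      simp [f]
      linear_combination x 0 * h1 - h2
    have mk : ∀ a b c d : F, a * a + u 0 * b + u 1 * c + u 2 * d = 0 →
        ∃ x : {x // f x = u}, x.1.1 0 = a ∧ x.1.1 4 = b ∧ x.1.1 5 = c ∧ x.1.1 6 = d := by
      intro a b c d h
      refine ⟨⟨⟨![a, u 0, u 1, u 2, b, c, d, -a], ?_⟩, ?_⟩, rfl, rfl, rfl, rfl⟩
      · rw [octForm_self_eq_zero_iff, octTrace_apply, octNorm]
        simp
        linear_combination -h
      · ext i
        fin_cases i <;> rfl
    have ext' : ∀ x y : {x // f x = u}, x.1.1 0 = y.1.1 0 → x.1.1 4 = y.1.1 4 →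
        x.1.1 5 = y.1.1 5 → x.1.1 6 = y.1.1 6 → x = y := by
      intro x y h0 h4 h5 h6
      obtain ⟨a1, a2, a3, a7, -⟩ := key x
      obtain ⟨b1, b2, b3, b7, -⟩ := key y
      apply Subtype.ext
      apply Subtype.ext
      ext i
      fin_cases i <;> simp [*]
    have hF : Nat.card F ^ 3 = Nat.card (F × F × F) := by
      rw [Nat.card_prod, Nat.card_prod]; ring
    rw [hF]
    by_cases h0 : u 0 = 0
    · by_cases h1 : u 1 = 0
      · by_cases h2 : u 2 = 0
        · refine Nat.card_eq_of_bijective (fun x => (x.1.1 4, x.1.1 5, x.1.1 6)) ⟨?_, ?_⟩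
          · intro x y hxy
            simp only [Prod.mk.injEq] at hxy
            have hx := (key x).2.2.2.2
            have hy := (key y).2.2.2.2
            simp [h0, h1, h2] at hx hy
            exact ext' x y (by rw [hx, hy]) hxy.1 hxy.2.1 hxy.2.2
          · rintro ⟨b, c, d⟩
            obtain ⟨x, hx⟩ := mk 0 b c d (by simp [h0, h1, h2])
            exact ⟨x, by simp [hx]⟩
        · refine Nat.card_eq_of_bijective (fun x => (x.1.1 0, x.1.1 4, x.1.1 5)) ⟨?_, ?_⟩
          · intro x y hxy
            simp only [Prod.mk.injEq] at hxy
            have hx := (key x).2.2.2.2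
            have hy := (key y).2.2.2.2
            rw [hxy.1, hxy.2.1, hxy.2.2] at hx
            exact ext' x y hxy.1 hxy.2.1 hxy.2.2
              (mul_left_cancel₀ h2 (by linear_combination hx - hy))
          · rintro ⟨a, b, c⟩
            obtain ⟨x, hx⟩ := mk a b c (-(a * a + u 0 * b + u 1 * c) / u 2) (by field_simp; ring)
            exact ⟨x, by simp [hx]⟩
      · refine Nat.card_eq_of_bijective (fun x => (x.1.1 0, x.1.1 4, x.1.1 6)) ⟨?_, ?_⟩
        · intro x y hxy
          simp only [Prod.mk.injEq] at hxy
          have hx := (key x).2.2.2.2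
          have hy := (key y).2.2.2.2
          rw [hxy.1, hxy.2.1, hxy.2.2] at hx
          exact ext' x y hxy.1 hxy.2.1
            (mul_left_cancel₀ h1 (by linear_combination hx - hy)) hxy.2.2
        · rintro ⟨a, b, d⟩
          obtain ⟨x, hx⟩ := mk a b (-(a * a + u 0 * b + u 2 * d) / u 1) d (by field_simp; ring)
          exact ⟨x, by simp [hx]⟩
    · refine Nat.card_eq_of_bijective (fun x => (x.1.1 0, x.1.1 5, x.1.1 6)) ⟨?_, ?_⟩
      · intro x y hxy
        simp only [Prod.mk.injEq] at hxy
        have hx := (key x).2.2.2.2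
        have hy := (key y).2.2.2.2
        rw [hxy.1, hxy.2.1, hxy.2.2] at hx
        exact ext' x y hxy.1
          (mul_left_cancel₀ h0 (by linear_combination hx - hy)) hxy.2.1 hxy.2.2
      · rintro ⟨a, c, d⟩
        obtain ⟨x, hx⟩ := mk a (-(a * a + u 1 * c + u 2 * d) / u 0) c d (by field_simp; ring)
        exact ⟨x, by simp [hx]⟩
  rw [card_eq_mul_of_card_fiber f _ hfib, Nat.card_fun, Nat.card_fin]
  ring

theorem isMooreBipartite_octForm :
    IsMooreBipartite (incidenceGraph (octForm F)) (Nat.card F + 1) 6 :=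
  isUniform_octForm.isMooreBipartite (card_isotropic_octForm F) (ediam_octForm F)

end Octonion

/-! ### Existence over the Galois fields and conclusion -/

theorem exists_isMooreBipartite {D : ℕ} (hD : D = 3 ∨ D = 4 ∨ D = 6) {q : ℕ}
    (hq : IsPrimePow q) :
    ∃ (n : ℕ) (B : SimpleGraph (Fin n)), IsMooreBipartite B (q + 1) D := by
  obtain ⟨p, k, hp, hk, rfl⟩ := hq
  have : Fact p.Prime := ⟨hp.nat_prime⟩
  have : Finite (GaloisField p k) :=
    Nat.finite_of_card_ne_zero (by
      rw [GaloisField.card p k hk.ne']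
      exact (pow_pos hp.nat_prime.pos k).ne')
  rw [← GaloisField.card p k hk.ne']
  rcases hD with rfl | rfl | rfl
  · exact (isMooreBipartite_planeForm _).exists_fin
  · exact (isMooreBipartite_symplecticForm _).exists_fin
  · exact (isMooreBipartite_octForm _).exists_fin

end BipMixed

theorem proposition5 (D : ℕ) (hD : D = 3 ∨ D = 4 ∨ D = 6) :
    -- Moore bipartite graphs of diameter `D` exist when the degree minus one is a prime power
    (∀ q : ℕ, IsPrimePow q →
      ∃ (n : ℕ) (B : SimpleGraph (Fin n)), BipMixed.IsMooreBipartite B (q + 1) D) ∧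
    -- their line digraphs are bipartite mixed graphs with `r = 1` and diameter `k = D + 1`
    (∀ (z : ℕ) (V : Type*) (B : SimpleGraph V), BipMixed.IsMooreBipartite B (z + 1) D →
      BipMixed.IsBipartite (BipMixed.lineDigraph (BipMixed.symmDigraph B)) ∧
      BipMixed.IsTotallyRegular (BipMixed.lineDigraph (BipMixed.symmDigraph B)) 1 z ∧
      BipMixed.ediam (BipMixed.lineDigraph (BipMixed.symmDigraph B)) = ((D + 1 : ℕ) : ℕ∞) ∧
      Nat.card (BipMixed.ArcSet (BipMixed.symmDigraph B)) =
        2 * (z + 1) * ∑ i ∈ Finset.range D, z ^ i) ∧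
    -- their orders asymptotically attain the Moore bound for bipartite mixed graphs
    (∀ ε : ℝ, 0 < ε → ∃ z₀ : ℕ, ∀ z : ℕ, z₀ ≤ z →
      ∀ (V : Type*) (B : SimpleGraph V), BipMixed.IsMooreBipartite B (z + 1) D →
        |(Nat.card (BipMixed.ArcSet (BipMixed.symmDigraph B)) : ℝ) /
          BipMixed.mooreBoundMixed 1 z (D + 1) - 1| < ε) := by
  refine ⟨fun q hq => BipMixed.exists_isMooreBipartite hD hq, fun z V B hB => ?_, fun ε hε => ?_⟩
  · have := hB.finite
    refine ⟨BipMixed.isBipartite_lineDigraph B hB.bipartite,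
      BipMixed.isTotallyRegular_lineDigraph B hB.regular,
      BipMixed.ediam_lineDigraph B (by omega) (fun v => ?_) hB.diam,
      hB.card_arcSet⟩
    exact Set.nonempty_of_ncard_ne_zero (s := B.neighborSet v) (by rw [hB.regular]; omega)
  · have h := BipMixed.tendsto_order_div_mooreBoundMixed D (by omega)
    obtain ⟨z₀, hz₀⟩ := Filter.eventually_atTop.1 (Metric.tendsto_nhds.1 h ε hε)
    refine ⟨z₀, fun z hz V B hB => ?_⟩
    rw [hB.card_arcSet]
    exact hz₀ z hz
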